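/- All graphs are finite and simple; $e(G)$ is the number of edges of $G$. $P_7$ is the path on $7$ vertices and $2P_7$ is the disjoint union of two copies of $P_7$; a graph is $2P_7$-free if it does not contain $2P_7$ as a (not necessarily induced) subgraph. For an integer $n\ge 14$ write $n=13+6t+r$ with integers $t\ge 0$ and $0\le r<6$, and put $$[n,14,7]=\binom{13}{2}+t\binom{6}{2}+\binom{r}{2}.$$ $K_m$ is the complete graph on $m$ vertices, $\overline{H}$ is the complement of $H$, $H_1\cup H_2$ is the disjoint union of $H_1$ and $H_2$, and $H_1+H_2$ is obtained from $H_1\cup H_2$ by joining every vertex of $H_1$ to every vertex of $H_2$. Let $G$ be a connected $2P_7$-free graph on $n\ge 14$ vertices. Then $$e(G)\le \max\{[n,14,7],\,5n-14\},$$ and equality holds only when $n\ge 22$ and $G$ is isomorphic to $K_5+(\overline{K_{n-7}}\cup K_2)$. -/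

import Mathlib

/-- The number `[n, m, ℓ]`, for `n ≥ m ≥ ℓ ≥ 3`: writing `n = (m - 1) + t (ℓ - 1) + r` with
`0 ≤ r < ℓ - 1`, it is `C(m - 1, 2) + t * C(ℓ - 1, 2) + C(r, 2)`. For `n ≤ m - 1` it is
`C(n, 2)`. -/
def pathBracket (n m l : ℕ) : ℕ :=
  if n ≤ m - 1 then n.choose 2
  else (m - 1).choose 2 + (n - (m - 1)) / (l - 1) * (l - 1).choose 2
    + ((n - (m - 1)) % (l - 1)).choose 2

/-- The join `G + H`: the disjoint union of `G` and `H` together with all edges between a vertex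
of `G` and a vertex of `H`. -/
def graphJoin {V W : Type*} (G : SimpleGraph V) (H : SimpleGraph W) : SimpleGraph (V ⊕ W) :=
  SimpleGraph.sum G H ⊔ completeBipartiteGraph V W

/-- `2P₇`: two disjoint copies of the path on seven vertices. -/
def twoP7 : SimpleGraph (Fin 7 ⊕ Fin 7) :=
  SimpleGraph.sum (SimpleGraph.pathGraph 7) (SimpleGraph.pathGraph 7)

/-- The graph `K₅ + (complement of K_{n-7} ∪ K₂)`, meant for `n ≥ 7`, where it has `n` vertices. -/
def extremalGraph (n : ℕ) : SimpleGraph (Fin 5 ⊕ (Fin (n - 7) ⊕ Fin 2)) :=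
  graphJoin (⊤ : SimpleGraph (Fin 5))
    (SimpleGraph.sum (⊤ : SimpleGraph (Fin (n - 7)))ᶜ (⊤ : SimpleGraph (Fin 2)))

/-! ### Paths and cycles as lists and periodic maps -/

/-- A path of `G`, as the list of its vertices. -/
def IsPathList {V : Type*} (G : SimpleGraph V) (l : List V) : Prop :=
  l.IsChain G.Adj ∧ l.Nodup

/-- A cycle of length `k` in `G`, as a `k`-periodic map from the integers. -/
structure CycMap {V : Type*} (G : SimpleGraph V) (k : ℕ) (c : ℤ → V) : Prop where
  eq_iff : ∀ i j, c i = c j ↔ (k : ℤ) ∣ i - j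
  adj : ∀ i, G.Adj (c i) (c (i + 1))

/-- The segment `c i, c (i + 1), …, c (i + t - 1)`. -/
def arc {V : Type*} (c : ℤ → V) (i : ℤ) (t : ℕ) : List V :=
  (List.range t).map fun s : ℕ => c (i + (s : ℤ))

section
variable {V : Type*} {G : SimpleGraph V}

theorem IsPathList.reverse {l : List V} (h : IsPathList G l) : IsPathList G l.reverse :=
  ⟨by rw [List.isChain_reverse]; simpa only [G.adj_comm] using h.1, List.nodup_reverse.2 h.2⟩

theorem twoP7_free_absurd (hfree : twoP7.Free G) {l m : List V} (hl : IsPathList G l)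
    (hm : IsPathList G m) (hl7 : l.length = 7) (hm7 : m.length = 7) (hd : l.Disjoint m) :
    False := by
  apply hfree
  have key : ∀ {l : List V} (hl : IsPathList G l) (hl7 : l.length = 7) (a b : Fin 7),
      (SimpleGraph.pathGraph 7).Adj a b →
        G.Adj (l.get (Fin.cast hl7.symm a)) (l.get (Fin.cast hl7.symm b)) := by
    intro l hl hl7 a b hab
    have hc := List.isChain_iff_getElem.1 hl.1
    rw [SimpleGraph.pathGraph_adj] at hab
    rcases hab with h | h
    · have := hc a.1 (by omega)
      simpa [← h] using this
    · have := (hc b.1 (by omega)).symm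
      simpa [← h] using this
  refine ⟨⟨⟨Sum.elim (fun a => l.get (Fin.cast hl7.symm a)) (fun a => m.get (Fin.cast hm7.symm a)),
    ?_⟩, ?_⟩⟩
  · rintro (a | a) (b | b) hab
    · exact key hl hl7 a b hab
    · simp [twoP7] at hab
    · simp [twoP7] at hab
    · exact key hm hm7 a b hab
  · rintro (a | a) (b | b) hab
    · have := hl.2.injective_get hab
      simpa [Fin.ext_iff] using this
    · exact (hd (List.get_mem l _) (by
        have h : l.get (Fin.cast hl7.symm a) = m.get (Fin.cast hm7.symm b) := hab
        rw [h]; exact List.get_mem m _)).elim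
    · exact (hd (List.get_mem l _) (by
        have h : m.get (Fin.cast hm7.symm a) = l.get (Fin.cast hl7.symm b) := hab
        rw [← h]; exact List.get_mem m _)).elim
    · have := hm.2.injective_get hab
      simpa [Fin.ext_iff] using this

theorem IsPathList.take {l : List V} (h : IsPathList G l) (n : ℕ) : IsPathList G (l.take n) :=
  ⟨h.1.take n, h.2.sublist (List.take_sublist n l)⟩

theorem IsPathList.drop {l : List V} (h : IsPathList G l) (n : ℕ) : IsPathList G (l.drop n) :=
  ⟨h.1.drop n, h.2.sublist (List.drop_sublist n l)⟩

theorem IsPathList.length_le (hfree : twoP7.Free G) {l : List V} (hl : IsPathList G l) :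
    l.length ≤ 13 := by
  by_contra! h
  refine twoP7_free_absurd hfree (hl.take 7) ((hl.drop 7).take 7) (by simp; omega)
    (by simp; omega) ?_
  have := List.disjoint_take_drop hl.2 (le_refl 7)
  exact List.disjoint_of_subset_right (List.take_subset _ _) this

theorem isPathList_append {l m : List V} : IsPathList G (l ++ m) ↔
    IsPathList G l ∧ IsPathList G m ∧ l.Disjoint m ∧
      ∀ x ∈ l.getLast?, ∀ y ∈ m.head?, G.Adj x y := by
  unfold IsPathList
  rw [List.isChain_append, List.nodup_append']
  tauto

theorem isPathList_cons {a : V} {l : List V} : IsPathList G (a :: l) ↔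
    (∀ y ∈ l.head?, G.Adj a y) ∧ a ∉ l ∧ IsPathList G l := by
  unfold IsPathList
  rw [List.isChain_cons, List.nodup_cons]
  tauto

section arc
variable (c : ℤ → V) (i : ℤ) (s t : ℕ)

@[simp] theorem length_arc : (arc c i t).length = t := by simp [arc]

@[simp] theorem arc_zero : arc c i 0 = [] := rfl

theorem arc_add : arc c i (s + t) = arc c i s ++ arc c (i + s) t := by
  simp [arc, List.range_add, List.map_append, Function.comp_def, add_assoc]

theorem arc_succ : arc c i (t + 1) = c i :: arc c (i + 1) t := by
  rw [add_comm, arc_add]; simp [arc]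

theorem arc_succ' : arc c i (t + 1) = arc c i t ++ [c (i + t)] := by
  rw [arc_add]; simp [arc]

theorem getLast?_arc_succ : (arc c i (t + 1)).getLast? = some (c (i + t)) := by
  rw [arc_succ']; simp

theorem head?_arc_succ : (arc c i (t + 1)).head? = some (c i) := by
  rw [arc_succ]; simp

variable {c i t}
theorem mem_arc {v : V} : v ∈ arc c i t ↔ ∃ s : ℕ, s < t ∧ c (i + s) = v := by
  simp [arc]

end arc

namespace CycMap
variable {k : ℕ} {c : ℤ → V}

theorem rotate (hc : CycMap G k c) (t : ℤ) : CycMap G k fun i => c (i + t) :=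
  ⟨fun i j => by rw [hc.eq_iff]; ring_nf, fun i => by
    have := hc.adj (i + t); rwa [show i + t + 1 = i + 1 + t by ring] at this⟩

theorem reflect (hc : CycMap G k c) : CycMap G k fun i => c (-i) :=
  ⟨fun i j => by
    rw [hc.eq_iff, ← dvd_neg]; ring_nf, fun i => by
    have := (hc.adj (-i - 1)).symm; rwa [show -i - 1 + 1 = -i by ring,
      show -i - 1 = -(i + 1) by ring] at this⟩

theorem isPathList_arc (hc : CycMap G k c) (i : ℤ) {t : ℕ} (ht : t ≤ k) :
    IsPathList G (arc c i t) := by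
  constructor
  · rw [arc, List.isChain_map, List.isChain_range]
    intro m _
    have := hc.adj (i + m)
    push_cast
    rwa [add_assoc] at this
  · rw [arc, List.nodup_map_iff_inj_on List.nodup_range]
    intro x hx y hy h
    rw [hc.eq_iff] at h
    rw [List.mem_range] at hx hy
    have h2 : |(i + x) - (i + y)| < (k : ℤ) := by rw [abs_lt]; constructor <;> omega
    have := Int.eq_zero_of_abs_lt_dvd h h2
    omega

theorem add_period (hc : CycMap G k c) (i : ℤ) : c (i + k) = c i := by
  rw [hc.eq_iff]; simp

theorem emod_eq (hc : CycMap G k c) (i : ℤ) : c (i % k) = c i := by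
  rw [hc.eq_iff]
  exact ⟨-(i / k), by rw [Int.emod_def]; ring⟩

theorem exists_eq (hc : CycMap G k c) (hk : 0 < k) (i j : ℤ) :
    ∃ t : ℕ, t < k ∧ c (i + t) = c j := by
  refine ⟨((j - i) % k).toNat, ?_, ?_⟩
  · have := Int.emod_lt_of_pos (j - i) (by exact_mod_cast hk : (0 : ℤ) < k)
    have := Int.emod_nonneg (j - i) (by omega : (k : ℤ) ≠ 0)
    omega
  · rw [Int.toNat_of_nonneg (Int.emod_nonneg _ (by omega)), hc.eq_iff]
    exact ⟨-((j - i) / k), by rw [Int.emod_def]; ring⟩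

theorem mem_arc_full (hc : CycMap G k c) (hk : 0 < k) (i j : ℤ) : c j ∈ arc c i k := by
  obtain ⟨t, ht, h⟩ := hc.exists_eq hk i j
  exact mem_arc.2 ⟨t, ht, h⟩

end CycMap

theorem cycMap_of_list {l : List V} (hl : IsPathList G l) (hpos : 0 < l.length)
    (hclose : ∀ x ∈ l.getLast?, ∀ y ∈ l.head?, G.Adj x y) :
    ∃ c, CycMap G l.length c ∧ ∀ i, c i ∈ l := by
  set k := l.length with hk
  have hlt : ∀ i : ℤ, (i % k).toNat < l.length := fun i => by
    have := Int.emod_lt_of_pos i (by exact_mod_cast hpos : (0 : ℤ) < k)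
    have := Int.emod_nonneg i (by omega : (k : ℤ) ≠ 0)
    omega
  refine ⟨fun i => l[(i % k).toNat]'(hlt i), ⟨fun i j => ?_, fun i => ?_⟩,
    fun i => List.getElem_mem _⟩
  · have h0 : (k : ℤ) ≠ 0 := by omega
    have h1 := Int.emod_nonneg i h0
    have h2 := Int.emod_nonneg j h0
    rw [hl.2.getElem_inj_iff, Int.dvd_iff_emod_eq_zero,
      ← Int.emod_eq_emod_iff_emod_sub_eq_zero]
    omega
  · have hc := List.isChain_iff_getElem.1 hl.1
    have hk0 : (0 : ℤ) < k := by exact_mod_cast hpos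
    have h1 := Int.emod_nonneg i hk0.ne'
    have h2 := Int.emod_lt_of_pos i hk0
    by_cases h : i % k + 1 = k
    · have h3 : ((i + 1) % k).toNat = 0 := by
        rw [← Int.emod_add_emod, h]; simp
      have h4 : (i % k).toNat = l.length - 1 := by omega
      apply hclose
      · simp [h4, List.getLast?_eq_getElem?]
      · simp [h3, List.head?_eq_getElem?]
    · have h3 : ((i + 1) % k).toNat = (i % k).toNat + 1 := by
        rw [← Int.emod_add_emod, Int.emod_eq_of_lt (by omega) (by omega)]; omega
      have := hc (i % k).toNat (by omega)
      simpa only [h3] using this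

end

/-! ### Extending paths and cycles -/

section
variable {V : Type*} {G : SimpleGraph V}

theorem exists_boundary_adj (hconn : G.Connected) {A : Set V} {x y : V} (hx : x ∈ A) (hy : y ∉ A) :
    ∃ u v, u ∈ A ∧ v ∉ A ∧ G.Adj u v := by
  obtain ⟨p⟩ := hconn.preconnected x y
  obtain ⟨d, -, h1, h2⟩ := p.exists_boundary_dart A hx hy
  exact ⟨d.fst, d.snd, h1, h2, d.adj⟩

theorem isPathList_singleton (v : V) : IsPathList G [v] := ⟨by simp, by simp⟩

theorem isPathList_pair {u v : V} (h : G.Adj u v) : IsPathList G [u, v] :=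
  ⟨by simp [h], by simp [h.ne]⟩

namespace CycMap
variable {k : ℕ} {c : ℤ → V}

theorem disjoint_arc {q : List V} (hd : ∀ v ∈ q, ∀ i, c i ≠ v) (i : ℤ) (t : ℕ) :
    q.Disjoint (arc c i t) := by
  intro v hv hv'
  obtain ⟨s, -, h⟩ := mem_arc.1 hv'
  exact hd v hv _ h

theorem arc_getLast? {i : ℤ} {t : ℕ} (ht : 0 < t) :
    (arc c i t).getLast? = some (c (i + t - 1)) := by
  obtain ⟨t, rfl⟩ : ∃ s, t = s + 1 := ⟨t - 1, by omega⟩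
  rw [getLast?_arc_succ]; push_cast; congr 2; ring

theorem arc_head? {i : ℤ} {t : ℕ} (ht : 0 < t) : (arc c i t).head? = some (c i) := by
  obtain ⟨t, rfl⟩ : ∃ s, t = s + 1 := ⟨t - 1, by omega⟩
  rw [head?_arc_succ]

theorem isPathList_append_arc (hc : CycMap G k c) {q : List V} (hq : IsPathList G q)
    (hd : ∀ v ∈ q, ∀ i, c i ≠ v) {i : ℤ} {t : ℕ} (ht : t ≤ k)
    (h : ∀ x ∈ q.getLast?, G.Adj x (c i)) : IsPathList G (q ++ arc c i t) := by
  refine isPathList_append.2 ⟨hq, hc.isPathList_arc i ht, disjoint_arc hd i t, ?_⟩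
  intro x hx y hy
  rcases Nat.eq_zero_or_pos t with rfl | h0
  · simp at hy
  · rw [arc_head? h0] at hy
    cases hy
    exact h x hx

theorem exists_replace_arc (hc : CycMap G k c) {q : List V} (hq : IsPathList G q)
    (hd : ∀ v ∈ q, ∀ i, c i ≠ v) {i j : ℤ} {t : ℕ} (ht0 : 0 < t) (ht : t ≤ k) (hj : j = i + t - 1)
    (hl : ∀ x ∈ q.getLast?, G.Adj x (c i)) (hh : ∀ x ∈ q.head?, G.Adj x (c j)) (hq0 : q ≠ []) :
    ∃ c', CycMap G (q.length + t) c' := by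
  have hp := hc.isPathList_append_arc hq hd ht hl
  have hlen : (q ++ arc c i t).length = q.length + t := by simp
  obtain ⟨c', h, -⟩ := cycMap_of_list hp (by omega) (by
    intro x hx y hy
    rw [List.getLast?_append, arc_getLast? ht0] at hx
    rw [List.head?_append_of_ne_nil _ hq0] at hy
    have hx' : c (i + t - 1) = x := by simpa using hx
    rw [← hx', ← hj]
    exact (hh y hy).symm)
  exact ⟨c', by rwa [hlen] at h⟩

theorem exists_insert (hc : CycMap G k c) (hk : 0 < k) {z : V} (hz : ∀ i, c i ≠ z) {i : ℤ}
    (h1 : G.Adj z (c i)) (h2 : G.Adj z (c (i + 1))) : ∃ c', CycMap G (k + 1) c' := by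
  have h3 := hc.exists_replace_arc (i := i + 1) (j := i + k) (t := k) (isPathList_singleton z)
    (by simpa using hz) hk le_rfl (by ring) (by simpa using h2)
    (by simpa [hc.add_period] using h1) (by simp)
  simpa [add_comm] using h3

theorem exists_crossing (hc : CycMap G k c) (hk : 0 < k) {z : V} (hz : ∀ i, c i ≠ z) {i j : ℤ}
    (h1 : G.Adj z (c i)) (h2 : G.Adj z (c j)) (h3 : G.Adj (c (i + 1)) (c (j + 1))) :
    ∃ c', CycMap G (k + 1) c' := by
  obtain ⟨t, ht, htj⟩ := hc.exists_eq hk i j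
  have htj1 : c (i + t + 1) = c (j + 1) := by
    rw [hc.eq_iff] at htj ⊢
    convert htj using 1; ring
  have ht0 : 0 < t := by
    rcases Nat.eq_zero_or_pos t with rfl | h
    · simp only [Nat.cast_zero, add_zero] at htj1
      rw [htj1] at h3
      exact (G.loopless.irrefl _ h3).elim
    · exact h
  have hfull := hc.isPathList_arc (i + 1) (t := t + (k - t)) (by omega)
  rw [arc_add] at hfull
  obtain ⟨ha, hb, hab, -⟩ := isPathList_append.1 hfull
  have hp : IsPathList G ((z :: (arc c (i + 1) t).reverse) ++ arc c (i + 1 + t) (k - t)) := by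
    refine isPathList_append.2 ⟨isPathList_cons.2 ⟨?_, ?_, ha.reverse⟩, hb, ?_, ?_⟩
    · intro y hy
      rw [List.head?_reverse, arc_getLast? ht0] at hy
      have : c (i + 1 + t - 1) = y := by simpa using hy
      rw [← this, show i + 1 + (t : ℤ) - 1 = i + t by ring, htj]; exact h2
    · intro h
      obtain ⟨s, -, hs⟩ := mem_arc.1 (List.mem_reverse.1 h)
      exact hz _ hs
    · intro v hv hv'
      rcases List.mem_cons.1 hv with rfl | hv
      · obtain ⟨s, -, hs⟩ := mem_arc.1 hv'
        exact hz _ hs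
      · exact hab (List.mem_reverse.1 hv) hv'
    · intro x hx y hy
      rw [arc_head? (by omega)] at hy
      have hne : (arc c (i + 1) t).reverse ≠ [] := by
        intro h; have := congrArg List.length h; simp at this; omega
      rw [List.getLast?_cons_of_ne_nil hne, List.getLast?_reverse, arc_head? ht0] at hx
      cases hx; cases hy
      rw [show i + 1 + (t : ℤ) = i + t + 1 by ring, htj1]; exact h3
  obtain ⟨c', h, -⟩ := cycMap_of_list hp (by simp) (by
    intro x hx y hy
    rw [List.getLast?_append, arc_getLast? (by omega)] at hx
    have hx' : c (i + 1 + t + (k - t : ℕ) - 1) = x := by simpa using hx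
    have hy' : z = y := by simpa using hy
    rw [← hx', ← hy', show i + 1 + (t : ℤ) + (k - t : ℕ) - 1 = i + k by omega, hc.add_period]
    exact h1.symm)
  refine ⟨c', ?_⟩
  rwa [show ((z :: (arc c (i + 1) t).reverse) ++ arc c (i + 1 + t) (k - t)).length = k + 1 by
    simp; omega] at h

section nolonger
variable (hc : CycMap G k c) (hk : 0 < k) (hmax : ∀ c', ¬ CycMap G (k + 1) c')
  {z : V} (hz : ∀ i, c i ≠ z) {i j : ℤ}
include hc hk hmax hz

theorem not_adj_succ (h : G.Adj z (c i)) : ¬ G.Adj z (c (i + 1)) := fun h2 =>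
  (hc.exists_insert hk hz h h2).elim hmax

theorem not_adj_succ_succ (h : G.Adj z (c i)) (h' : G.Adj z (c j)) :
    ¬ G.Adj (c (i + 1)) (c (j + 1)) := fun h2 =>
  (hc.exists_crossing hk hz h h' h2).elim hmax

theorem not_adj_pred_pred (h : G.Adj z (c i)) (h' : G.Adj z (c j)) :
    ¬ G.Adj (c (i - 1)) (c (j - 1)) := fun h2 => by
  refine (hc.reflect.exists_crossing hk (i := -i) (j := -j) (fun i => hz _) (by simpa using h)
    (by simpa using h') ?_).elim hmax
  rwa [show -(-i + 1) = i - 1 by ring, show -(-j + 1) = j - 1 by ring]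

end nolonger

theorem length_lt (hfree : twoP7.Free G) (hconn : G.Connected) [Fintype V]
    (hcard : 14 ≤ Fintype.card V) (hc : CycMap G k c) : k ≤ 12 := by
  by_contra! hk
  have h13 := (hc.isPathList_arc 0 le_rfl).length_le hfree
  rw [length_arc] at h13
  obtain rfl : k = 13 := by omega
  classical
  obtain ⟨y, hy⟩ : ∃ y, y ∉ (arc c 0 13).toFinset := by
    by_contra! h
    have h1 : Fintype.card V ≤ (arc c 0 13).toFinset.card := Finset.card_le_card fun v _ => h v
    have h2 := List.toFinset_card_le (arc c 0 13)
    simp only [length_arc] at h2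
    omega
  obtain ⟨u, v, ⟨i, hi⟩, hv, huv⟩ := exists_boundary_adj hconn (A := Set.range c)
    (x := c 0) (y := y) ⟨0, rfl⟩ (by
      rintro ⟨i, rfl⟩
      exact hy (List.mem_toFinset.2 (hc.mem_arc_full (by omega) 0 i)))
  have hp := (hc.isPathList_append_arc (q := [v]) (i := i) (isPathList_singleton v)
    (by
      intro w hw i hi'
      rw [List.mem_singleton] at hw
      exact hv ⟨i, hi'.trans hw⟩) le_rfl
    (by
      intro x hx
      have : v = x := by simpa using hx
      rw [← this, hi]; exact huv.symm)).length_le hfree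
  simp at hp

end CycMap

end

/-! ### Counting in subsets of a cycle -/

/-- Bounded conjunction. -/
def allBelow : ℕ → (ℕ → Bool) → Bool
  | 0, _ => true
  | n + 1, p => p n && allBelow n p

/-- Bounded sum. -/
def sumBelow : ℕ → (ℕ → ℕ) → ℕ
  | 0, _ => 0
  | n + 1, f => sumBelow n f + f n

theorem allBelow_iff {n : ℕ} {p : ℕ → Bool} : allBelow n p = true ↔ ∀ i < n, p i = true := by
  induction n with
  | zero => simp [allBelow]
  | succ n ih =>
    rw [allBelow, Bool.and_eq_true, ih]
    constructor
    · rintro ⟨h1, h2⟩ i hi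
      rcases Nat.lt_succ_iff_lt_or_eq.1 hi with h | rfl
      · exact h2 i h
      · exact h1
    · exact fun h => ⟨h n (by omega), fun i hi => h i (by omega)⟩

theorem sumBelow_eq (n : ℕ) (f : ℕ → ℕ) : sumBelow n f = ∑ i ∈ Finset.range n, f i := by
  induction n with
  | zero => simp [sumBelow]
  | succ n ih => rw [sumBelow, ih, Finset.sum_range_succ]

/-- Membership of the residue of `i` modulo `k` in the subset with bit mask `m`. -/
def cycBit (k m i : ℕ) : Bool := m.testBit (i % k)

/-- The subset with mask `m` contains no two cyclically consecutive residues. -/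
def sparse (k m : ℕ) : Bool := allBelow k fun i => !(cycBit k m i && cycBit k m (i + 1))

/-- The size of the subset with mask `m`. -/
def maskCard (k m : ℕ) : ℕ := sumBelow k fun i => (cycBit k m i).toNat

/-- The number of ordered pairs of distinct residues that neither both follow nor both precede
elements of the subset with mask `m`. -/
def freePairs (k m : ℕ) : ℕ := sumBelow k fun i => sumBelow k fun j =>
  (!(i == j || (cycBit k m (i + 1) && cycBit k m (j + 1)) ||
    (cycBit k m (i + (k - 1)) && cycBit k m (j + (k - 1))))).toNat

/-- The number of residues modulo `12` at distance other than `1` and `6` from the subset with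
mask `m`. -/
def freePoints (m : ℕ) : ℕ := sumBelow 12 fun i =>
  (!(cycBit 12 m (i + 1) || cycBit 12 m (i + 11) || cycBit 12 m (i + 6))).toNat

/-- The subset with mask `m` is a translate of the one with mask `p`. -/
def isTranslate (k p m : ℕ) : Bool :=
  !(allBelow k fun t => !(allBelow k fun i => cycBit k m (i + t) == cycBit k p i))

/-- The number of residues at distance `0` or at least `r` from every element of the subset with
mask `m`. -/
def farPoints (k r m : ℕ) : ℕ := sumBelow k fun j =>
  (allBelow k fun i => !(cycBit k m i) || i == j ||
    (decide (r ≤ (i + (k - j)) % k) && decide (r ≤ (j + (k - i)) % k))).toNat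

set_option maxRecDepth 100000 in
theorem mask_twelve : allBelow 4096 (fun m => !(sparse 12 m) || match maskCard 12 m with
    | 0 => true | 1 => true | 2 => true
    | 3 => decide (freePairs 12 m ≤ 126)
    | 4 => decide (freePairs 12 m ≤ 110) || (decide (freePairs 12 m ≤ 114) && decide (freePoints m ≤ 3))
    | 5 => (decide (freePairs 12 m ≤ 104) && decide (freePoints m ≤ 3)) || isTranslate 12 661 m
    | 6 => decide (freePairs 12 m ≤ 102) && decide (freePoints m = 0)
    | _ => false) = true := by
  decide +kernel

set_option maxRecDepth 100000 in
theorem mask_eleven : allBelow 2048 (fun m => !(sparse 11 m) || match maskCard 11 m with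
    | 0 => true | 1 => true | 2 => true | 3 => true
    | 4 => decide (freePairs 11 m ≤ 92)
    | 5 => decide (freePairs 11 m ≤ 82) && isTranslate 11 341 m
    | _ => false) = true := by
  decide +kernel

set_option maxRecDepth 100000 in
theorem mask_ten : allBelow 1024 (fun m => !(sparse 10 m) || match maskCard 10 m with
    | 0 => true | 1 => true | 2 => true
    | 3 => decide (farPoints 10 4 m ≤ 2)
    | 4 => decide (farPoints 10 3 m ≤ 1) && decide (farPoints 10 4 m ≤ 2)
    | 5 => decide (farPoints 10 3 m ≤ 1) && decide (farPoints 10 4 m ≤ 2) && isTranslate 10 341 m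
    | _ => false) = true := by
  decide +kernel

/-! ### Counting adjacent pairs -/

section
variable {V : Type*} (G : SimpleGraph V) [DecidableRel G.Adj]

/-- The number of pairs in `S × T` that are adjacent in `G`. -/
def adjSum (S T : Finset V) : ℕ := ∑ x ∈ S, ∑ y ∈ T, if G.Adj x y then 1 else 0

variable {G}

theorem adjSum_comm (S T : Finset V) : adjSum G S T = adjSum G T S := by
  unfold adjSum; rw [Finset.sum_comm]; simp only [G.adj_comm]

theorem adjSum_univ [Fintype V] : adjSum G Finset.univ Finset.univ = 2 * G.edgeFinset.card := by
  rw [← G.sum_degrees_eq_twice_card_edges]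
  unfold adjSum
  refine Finset.sum_congr rfl fun v _ => ?_
  rw [← Finset.card_filter, ← G.card_neighborFinset_eq_degree, G.neighborFinset_eq_filter]

variable [DecidableEq V]

theorem adjSum_union_left {S T : Finset V} (h : Disjoint S T) (U : Finset V) :
    adjSum G (S ∪ T) U = adjSum G S U + adjSum G T U := by
  unfold adjSum; rw [Finset.sum_union h]

theorem adjSum_union_right {S T : Finset V} (h : Disjoint S T) (U : Finset V) :
    adjSum G U (S ∪ T) = adjSum G U S + adjSum G U T := by
  rw [adjSum_comm, adjSum_union_left h, adjSum_comm S, adjSum_comm T]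

theorem adjSum_union_self {S T : Finset V} (h : Disjoint S T) :
    adjSum G (S ∪ T) (S ∪ T) = adjSum G S S + 2 * adjSum G T S + adjSum G T T := by
  rw [adjSum_union_left h, adjSum_union_right h, adjSum_union_right h, adjSum_comm S T]; ring

theorem adjSum_sdiff_self {S T : Finset V} (h : T ⊆ S) :
    adjSum G S S = adjSum G T T + 2 * adjSum G (S \ T) T + adjSum G (S \ T) (S \ T) := by
  rw [← adjSum_union_self Finset.disjoint_sdiff, Finset.union_sdiff_of_subset h]

omit [DecidableEq V] in
theorem adjSum_eq_card (S T : Finset V) :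
    adjSum G S T = ((S ×ˢ T).filter fun p => G.Adj p.1 p.2).card := by
  rw [Finset.card_filter, Finset.sum_product]; rfl

theorem adjSum_self_le (S : Finset V) : adjSum G S S + S.card ≤ S.card * S.card := by
  rw [adjSum_eq_card, ← Finset.card_product, ← Finset.diag_card S, ← Finset.card_union_of_disjoint]
  · apply Finset.card_le_card
    intro p hp
    simp only [Finset.mem_union, Finset.mem_filter, Finset.mem_product, Finset.mem_diag] at hp ⊢
    rcases hp with h | ⟨h, h'⟩
    · exact h.1
    · exact ⟨h, h' ▸ h⟩
  · rw [Finset.disjoint_left]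
    intro p hp hp'
    rw [Finset.mem_diag] at hp'
    exact (Finset.mem_filter.1 hp).2.ne hp'.2

omit [DecidableEq V] in
theorem adjSum_eq_zero {S T : Finset V} (h : ∀ x ∈ S, ∀ y ∈ T, ¬ G.Adj x y) :
    adjSum G S T = 0 :=
  Finset.sum_eq_zero fun x hx => Finset.sum_eq_zero fun y hy => if_neg (h x hx y hy)

end

/-! ### Neighbours on a cycle -/

section
variable {V : Type*} {G : SimpleGraph V} [DecidableRel G.Adj] {k : ℕ} {c : ℤ → V} {C : Finset V}

/-- The number of neighbours of `z` in `C`. -/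
def degIn (G : SimpleGraph V) [DecidableRel G.Adj] (C : Finset V) (z : V) : ℕ :=
  ∑ y ∈ C, if G.Adj z y then 1 else 0

theorem adjSum_eq_sum_degIn (S T : Finset V) : adjSum G S T = ∑ x ∈ S, degIn G T x := rfl

/-- The bit mask of the positions of the neighbours of `z` on the cycle `c`. -/
def nbrMask (G : SimpleGraph V) [DecidableRel G.Adj] (k : ℕ) (c : ℤ → V) (z : V) : ℕ :=
  Nat.ofBits fun i : Fin k => decide (G.Adj z (c (i : ℕ)))

namespace CycMap

theorem cycBit_nbrMask (hc : CycMap G k c) (hk : 0 < k) (z : V) (i : ℕ) :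
    cycBit k (nbrMask G k c z) i = decide (G.Adj z (c i)) := by
  rw [cycBit, nbrMask, Nat.testBit_ofBits_lt _ _ (Nat.mod_lt _ hk)]
  have := hc.emod_eq i
  simp only [← this]
  norm_cast

omit [DecidableRel G.Adj] in
theorem sum_eq (hc : CycMap G k c) (hC : ∀ v, v ∈ C ↔ ∃ i, c i = v) (hk : 0 < k) (f : V → ℕ) :
    ∑ y ∈ C, f y = ∑ i ∈ Finset.range k, f (c i) := by
  classical
  have : C = (Finset.range k).image fun i : ℕ => c i := by
    ext v
    rw [hC, Finset.mem_image]
    constructor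
    · rintro ⟨j, rfl⟩
      obtain ⟨t, ht, h⟩ := hc.exists_eq hk 0 j
      exact ⟨t, Finset.mem_range.2 ht, by simpa using h⟩
    · rintro ⟨i, -, h⟩; exact ⟨_, h⟩
  rw [this, Finset.sum_image]
  intro x hx y hy h
  rw [Finset.coe_range, Set.mem_Iio] at hx hy
  have h := (hc.eq_iff _ _).1 h
  have h2 : |(x : ℤ) - y| < (k : ℤ) := by rw [abs_lt]; constructor <;> omega
  have := Int.eq_zero_of_abs_lt_dvd h h2
  omega

omit [DecidableRel G.Adj] in
theorem card_eq (hc : CycMap G k c) (hC : ∀ v, v ∈ C ↔ ∃ i, c i = v) (hk : 0 < k) :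
    C.card = k := by
  have := hc.sum_eq hC hk fun _ => 1
  simpa using this

theorem degIn_eq (hc : CycMap G k c) (hC : ∀ v, v ∈ C ↔ ∃ i, c i = v) (hk : 0 < k) (z : V) :
    degIn G C z = maskCard k (nbrMask G k c z) := by
  rw [degIn, hc.sum_eq hC hk, maskCard, sumBelow_eq]
  refine Finset.sum_congr rfl fun i _ => ?_
  rw [hc.cycBit_nbrMask hk]
  by_cases h : G.Adj z (c i) <;> simp [h]

theorem adjSum_eq (hc : CycMap G k c) (hC : ∀ v, v ∈ C ↔ ∃ i, c i = v) (hk : 0 < k) :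
    adjSum G C C = sumBelow k fun i => sumBelow k fun j => if G.Adj (c i) (c j) then 1 else 0 := by
  rw [adjSum, hc.sum_eq hC hk, sumBelow_eq]
  refine Finset.sum_congr rfl fun i _ => ?_
  rw [hc.sum_eq hC hk, sumBelow_eq]

theorem nbrMask_lt (z : V) : nbrMask G k c z < 2 ^ k := Nat.ofBits_lt_two_pow _

section nolonger
variable (hc : CycMap G k c) (hk : 0 < k) (hmax : ∀ c', ¬ CycMap G (k + 1) c')
  {z : V} (hz : ∀ i, c i ≠ z)
include hc hk hmax hz

theorem sparse_nbrMask : sparse k (nbrMask G k c z) = true := by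
  rw [sparse, allBelow_iff]
  intro i _
  rw [hc.cycBit_nbrMask hk, hc.cycBit_nbrMask hk, ← Bool.decide_and, ← decide_not, decide_eq_true_iff]
  rintro ⟨h1, h2⟩
  exact hc.not_adj_succ hk hmax hz h1 (by exact_mod_cast h2)

theorem pair_le_free (i j : ℕ) : (if G.Adj (c i) (c j) then 1 else 0) ≤
    (!(i == j || (cycBit k (nbrMask G k c z) (i + 1) && cycBit k (nbrMask G k c z) (j + 1)) ||
    (cycBit k (nbrMask G k c z) (i + (k - 1)) &&
      cycBit k (nbrMask G k c z) (j + (k - 1))))).toNat := by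
  split_ifs with h
  · have h1 : (i == j) = false := by
      rw [beq_eq_false_iff_ne]; rintro rfl; exact G.loopless.irrefl _ h
    have h2 : (cycBit k (nbrMask G k c z) (i + 1) && cycBit k (nbrMask G k c z) (j + 1)) = false := by
      rw [hc.cycBit_nbrMask hk, hc.cycBit_nbrMask hk, ← Bool.decide_and, decide_eq_false_iff_not]
      rintro ⟨h1, h2⟩
      refine hc.not_adj_pred_pred hk hmax hz h1 h2 ?_
      simpa using h
    have h3 : (cycBit k (nbrMask G k c z) (i + (k - 1)) &&
        cycBit k (nbrMask G k c z) (j + (k - 1))) = false := by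
      rw [hc.cycBit_nbrMask hk, hc.cycBit_nbrMask hk, ← Bool.decide_and, decide_eq_false_iff_not]
      rintro ⟨h1, h2⟩
      refine hc.not_adj_succ_succ hk hmax hz h1 h2 ?_
      have e : ∀ i : ℕ, c (((i + (k - 1) : ℕ) : ℤ) + 1) = c i := fun i => by
        rw [show (((i + (k - 1) : ℕ) : ℤ) + 1) = (i : ℤ) + k by omega, hc.add_period]
      rw [e, e]; exact h
    rw [h1, h2, h3]; simp
  · exact Nat.zero_le _

theorem adjSum_le_freePairs (hC : ∀ v, v ∈ C ↔ ∃ i, c i = v) :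
    adjSum G C C ≤ freePairs k (nbrMask G k c z) := by
  rw [hc.adjSum_eq hC hk, freePairs, sumBelow_eq, sumBelow_eq]
  refine Finset.sum_le_sum fun i _ => ?_
  rw [sumBelow_eq, sumBelow_eq]
  exact Finset.sum_le_sum fun j _ => hc.pair_le_free hk hmax hz i j

end nolonger

theorem exists_translate (hc : CycMap G k c) (hk : 0 < k) {z : V} {p : ℕ}
    (h : isTranslate k p (nbrMask G k c z) = true) :
    ∃ t : ℤ, ∀ i : ℕ, i < k → (G.Adj z (c (i + t)) ↔ p.testBit i = true) := by
  rw [isTranslate, Bool.not_eq_true', ← Bool.not_eq_true, allBelow_iff] at h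
  push Not at h
  obtain ⟨t, -, ht⟩ := h
  rw [ne_eq, Bool.not_eq_true, Bool.not_eq_false', allBelow_iff] at ht
  refine ⟨t, fun i hi => ?_⟩
  have := ht i hi
  rw [hc.cycBit_nbrMask hk, beq_iff_eq, cycBit, Nat.mod_eq_of_lt hi] at this
  rw [← this, decide_eq_true_iff]
  norm_cast

end CycMap

end

/-! ### The numerical bounds -/

theorem pathBracket_table (n : ℕ) : (n = 14 → pathBracket n 14 7 = 78) ∧
    (n = 15 → pathBracket n 14 7 = 79) ∧ (n = 16 → pathBracket n 14 7 = 81) ∧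
    (n = 17 → pathBracket n 14 7 = 84) ∧ (n = 18 → pathBracket n 14 7 = 88) ∧
    (n = 19 → pathBracket n 14 7 = 93) ∧ (n = 20 → pathBracket n 14 7 = 93) ∧
    (n = 21 → pathBracket n 14 7 = 94) ∧ (n = 22 → pathBracket n 14 7 = 96) := by
  refine ⟨?_, ?_, ?_, ?_, ?_, ?_, ?_, ?_, ?_⟩ <;> rintro rfl <;> decide

theorem lt_bound {n e : ℕ} (hn : 14 ≤ n) (h : e ≤ 5 * n - 15 ∨ e ≤ 4 * n + 5 ∨ e ≤ 4 * n + 7 ∨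
    e ≤ 3 * n + 27 ∨ e ≤ 2 * n + 42 ∨ 2 * e ≤ 7 * n + 33 ∨ 2 * e ≤ 9 * n - 7) :
    e < max (pathBracket n 14 7) (5 * n - 14) := by
  rw [lt_max_iff]
  obtain ⟨h14, h15, h16, h17, h18, h19, h20, h21, h22⟩ := pathBracket_table n
  generalize pathBracket n 14 7 = b at *
  rcases Nat.lt_or_ge n 23 with h23 | h23
  · interval_cases n <;> simp at * <;> omega
  · right; omega

theorem lt_bound_of_le {n e : ℕ} (hn : 14 ≤ n) (h : e ≤ 5 * n - 14) (h22 : n < 22) :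
    e < max (pathBracket n 14 7) (5 * n - 14) := by
  rw [lt_max_iff]
  obtain ⟨h14, h15, h16, h17, h18, h19, h20, h21, -⟩ := pathBracket_table n
  generalize pathBracket n 14 7 = b at *
  interval_cases n <;> simp at * <;> omega

/-! ### Graphs with a cycle of length twelve -/

section
variable {V : Type*} {G : SimpleGraph V}

/-- Two disjoint paths on seven vertices, given by index lists into fourteen distinct vertices. -/
theorem twoP7_absurd_of_map (hfree : twoP7.Free G) {f : Fin 14 → V} (hf : f.Injective)
    (a b : List (Fin 14)) (ha : a.length = 7) (hb : b.length = 7) (hab : (a ++ b).Nodup)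
    (hac : (a.map f).IsChain G.Adj) (hbc : (b.map f).IsChain G.Adj) : False := by
  rw [List.nodup_append'] at hab
  refine twoP7_free_absurd hfree ⟨hac, hab.1.map hf⟩ ⟨hbc, hab.2.1.map hf⟩ (by simpa) (by simpa) ?_
  intro v hv hv'
  obtain ⟨i, hi, rfl⟩ := List.mem_map.1 hv
  obtain ⟨j, hj, h⟩ := List.mem_map.1 hv'
  rw [hf h] at hj
  exact hab.2.2 hi hj

namespace CycMap
variable {c : ℤ → V}

section two
variable (hfree : twoP7.Free G) (hc : CycMap G 12 c) {z w : V} (hz : ∀ i, c i ≠ z)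
  (hw : ∀ i, c i ≠ w) (hzw : z ≠ w)
include hfree hc hz hw hzw

theorem twelve_not_adj_succ {i : ℤ} (h : G.Adj z (c i)) : ¬ G.Adj w (c (i + 1)) := by
  intro h'
  have hp : IsPathList G ([w] ++ arc c (i + 1) 12) :=
    hc.isPathList_append_arc (isPathList_singleton w) (by simpa using hw) le_rfl (by simpa using h')
  have hp2 : IsPathList G (([w] ++ arc c (i + 1) 12) ++ [z]) := by
    refine isPathList_append.2 ⟨hp, isPathList_singleton z, ?_, ?_⟩
    · rw [List.disjoint_singleton]
      simp only [List.singleton_append, List.mem_cons, not_or]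
      refine ⟨hzw, fun h => ?_⟩
      obtain ⟨s, -, hs⟩ := mem_arc.1 h
      exact hz _ hs
    · intro x hx y hy
      rw [List.getLast?_append, arc_getLast? (by omega)] at hx
      have hx' : c (i + 1 + (12 : ℕ) - 1) = x := by simpa using hx
      have hy' : z = y := by simpa using hy
      have := hc.add_period i
      rw [← hx', ← hy', show i + 1 + ((12 : ℕ) : ℤ) - 1 = i + (12 : ℕ) by ring, this]
      exact h.symm
  have := hp2.length_le hfree
  simp at this

theorem twelve_not_adj_add_six {i : ℤ} (h : G.Adj z (c i)) : ¬ G.Adj w (c (i + 6)) := by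
  intro h'
  have hp : IsPathList G ([z] ++ arc c i 6) :=
    hc.isPathList_append_arc (isPathList_singleton z) (by simpa using hz) (by omega)
      (by simpa using h)
  have hq : IsPathList G ([w] ++ arc c (i + 6) 6) :=
    hc.isPathList_append_arc (isPathList_singleton w) (by simpa using hw) (by omega)
      (by simpa using h')
  have hd := hc.isPathList_arc i (t := 6 + 6) (by omega)
  rw [arc_add] at hd
  refine twoP7_free_absurd hfree hp hq (by simp) (by simp) ?_
  intro v hv hv'
  simp only [List.singleton_append, List.mem_cons] at hv hv'
  rcases hv with rfl | hv <;> rcases hv' with rfl | hv'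
  · exact hzw rfl
  · obtain ⟨s, -, hs⟩ := mem_arc.1 hv'
    exact hz _ hs
  · obtain ⟨s, -, hs⟩ := mem_arc.1 hv
    exact hw _ hs
  · exact (isPathList_append.1 hd).2.2.1 hv hv'

omit hfree in
/-- The twelve vertices of a cycle together with two outer vertices. -/
theorem twelve_injective : Function.Injective
    (fun i : Fin 14 => if i.1 < 12 then c (i.1 : ℤ) else if i.1 = 12 then z else w) := by
  intro i j h
  have hlt := i.2
  have hlt' := j.2
  simp only at h
  split_ifs at h with h1 h2 h3 h4 h5 h6 h7 h8
  · rw [hc.eq_iff] at h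
    ext; omega
  all_goals first
    | exact (hz _ h).elim | exact (hw _ h).elim | exact (hz _ h.symm).elim
    | exact (hw _ h.symm).elim | exact (hzw h).elim | exact (hzw h.symm).elim | (ext; omega)

/-- If two outer vertices are adjacent to the vertices at `0, 2, 4, 7, 9`, then four further
chords are missing. -/
theorem twelve_no_chords (h0 : G.Adj z (c 0)) (h2 : G.Adj z (c 2)) (h4 : G.Adj z (c 4))
    (h7 : G.Adj z (c 7)) (h4' : G.Adj w (c 4))
    (h7' : G.Adj w (c 7)) (h9' : G.Adj w (c 9)) :
    ¬ G.Adj (c 5) (c 9) ∧ ¬ G.Adj (c 5) (c 0) ∧ ¬ G.Adj (c 5) (c 11) ∧ ¬ G.Adj (c 6) (c 10) := by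
  have hf := twelve_injective hc hz hw hzw
  have a0 := hc.adj 0
  have a1 := hc.adj 1
  have a2 := hc.adj 2
  have a3 := hc.adj 3
  have a4 := hc.adj 4
  have a5 := hc.adj 5
  have a6 := hc.adj 6
  have a7 := hc.adj 7
  have a8 := hc.adj 8
  have a9 := hc.adj 9
  have a10 := hc.adj 10
  have a11 := hc.adj 11
  have e12 : c 12 = c 0 := (hc.eq_iff 12 0).2 (by norm_num)
  norm_num [e12] at a0 a1 a2 a3 a4 a5 a6 a7 a8 a9 a10 a11
  refine ⟨fun h => ?_, fun h => ?_, fun h => ?_, fun h => ?_⟩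
  · refine twoP7_absurd_of_map hfree hf [6, 5, 9, 10, 11, 0, 1] [12, 2, 3, 4, 13, 7, 8] rfl rfl
      (by decide) ?_ ?_ <;> simp [*, a5.symm, h4'.symm]
  · refine twoP7_absurd_of_map hfree hf [6, 5, 0, 11, 10, 9, 8] [1, 2, 3, 4, 12, 7, 13] rfl rfl
      (by decide) ?_ ?_ <;>
      simp [*, a5.symm, a11.symm, a10.symm, a9.symm, a8.symm, h4.symm, h7'.symm]
  · refine twoP7_absurd_of_map hfree hf [6, 5, 11, 10, 9, 8, 7] [12, 0, 1, 2, 3, 4, 13] rfl rfl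
      (by decide) ?_ ?_ <;>
      simp [*, a5.symm, a10.symm, a9.symm, a8.symm, a7.symm, h4'.symm]
  · refine twoP7_absurd_of_map hfree hf [5, 6, 10, 11, 0, 1, 2] [3, 4, 12, 7, 8, 9, 13] rfl rfl
      (by decide) ?_ ?_ <;> simp [*, h4.symm, h9'.symm]

end two


section count
variable [Fintype V] [DecidableEq V] [DecidableRel G.Adj] {C : Finset V}

/-- Outside a cycle of length twelve all edges go to the cycle. -/
theorem twelve_two_mul_card (hfree : twoP7.Free G) (hconn : G.Connected) (hc : CycMap G 12 c)
    (hC : ∀ v, v ∈ C ↔ ∃ i, c i = v) :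
    2 * G.edgeFinset.card = adjSum G C C + 2 * ∑ z ∈ Finset.univ \ C, degIn G C z := by
  have key : ∀ z, z ∉ C → ∀ i, G.Adj z (c i) → ∀ y, y ∉ C → ¬ G.Adj z y := by
    intro z hz i hi y hy hzy
    have hp := (hc.isPathList_append_arc (q := [y, z]) (i := i) (isPathList_pair hzy.symm)
      (by
        intro v hv j hj
        have hvC : v ∈ C := (hC v).2 ⟨j, hj⟩
        simp only [List.mem_cons, List.not_mem_nil, or_false] at hv
        rcases hv with rfl | rfl
        · exact hy hvC
        · exact hz hvC) le_rfl (by simpa using hi)).length_le hfree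
    simp at hp
  have hatt : ∀ z, z ∉ C → ∃ i, G.Adj z (c i) := by
    intro z hz
    by_contra hno
    obtain ⟨u, v, hu, hv, huv⟩ := exists_boundary_adj hconn
      (A := {v | v ∈ C ∨ ∃ i, G.Adj v (c i)}) (x := c 0) (y := z)
      (Or.inl ((hC _).2 ⟨0, rfl⟩)) (by rintro (h | h); exacts [hz h, hno h])
    simp only [Set.mem_ofPred_eq, not_or] at hu hv
    by_cases huC : u ∈ C
    · obtain ⟨i, rfl⟩ := (hC u).1 huC
      exact hv.2 ⟨i, huv.symm⟩
    · obtain ⟨i, hi⟩ := hu.resolve_left huC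
      exact key u huC i hi v hv.1 huv
  have h0 : adjSum G (Finset.univ \ C) (Finset.univ \ C) = 0 := by
    refine adjSum_eq_zero fun x hx y hy => ?_
    rw [Finset.mem_sdiff] at hx hy
    obtain ⟨i, hi⟩ := hatt x hx.2
    exact key x hx.2 i hi y hy.2
  rw [← adjSum_univ, adjSum_sdiff_self (Finset.subset_univ C), h0, adjSum_eq_sum_degIn _ C]
  rfl

omit [Fintype V] [DecidableEq V] in
theorem degIn_le_freePoints (hfree : twoP7.Free G) (hc : CycMap G 12 c)
    (hC : ∀ v, v ∈ C ↔ ∃ i, c i = v) {z w : V} (hz : z ∉ C) (hw : w ∉ C) (hzw : z ≠ w) :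
    degIn G C w ≤ freePoints (nbrMask G 12 c z) := by
  have hz' : ∀ i, c i ≠ z := fun i h => hz ((hC z).2 ⟨i, h⟩)
  have hw' : ∀ i, c i ≠ w := fun i h => hw ((hC w).2 ⟨i, h⟩)
  rw [hc.degIn_eq hC (by norm_num), maskCard, freePoints, sumBelow_eq, sumBelow_eq]
  refine Finset.sum_le_sum fun i _ => ?_
  simp only [hc.cycBit_nbrMask (by norm_num : 0 < 12)]
  by_cases h : G.Adj w (c i)
  · have h1 : ¬ G.Adj z (c ((i + 1 : ℕ) : ℤ)) := fun h' =>
      hc.twelve_not_adj_succ hfree hw' hz' hzw.symm h (by exact_mod_cast h')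
    have h2 : ¬ G.Adj z (c ((i + 11 : ℕ) : ℤ)) := fun h' => by
      refine hc.twelve_not_adj_succ hfree hz' hw' hzw h' ?_
      rwa [show ((i + 11 : ℕ) : ℤ) + 1 = (i : ℤ) + (12 : ℕ) by push_cast; ring, hc.add_period]
    have h3 : ¬ G.Adj z (c ((i + 6 : ℕ) : ℤ)) := fun h' =>
      hc.twelve_not_adj_add_six hfree hw' hz' hzw.symm h (by exact_mod_cast h')
    simp only [decide_eq_false h1, decide_eq_false h2, decide_eq_false h3]
    simp [h]
  · simp [h]

theorem sum_degIn_le {z : V} (hz : z ∉ C) {b : ℕ}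
    (hb : ∀ w, w ∉ C → z ≠ w → degIn G C w ≤ b) :
    ∑ w ∈ Finset.univ \ C, degIn G C w ≤ degIn G C z + (Fintype.card V - C.card - 1) * b := by
  have hzm : z ∈ Finset.univ \ C := by simpa using hz
  rw [← Finset.add_sum_erase _ _ hzm]
  refine Nat.add_le_add_left ?_ _
  refine (Finset.sum_le_card_nsmul _ _ b ?_).trans ?_
  · intro w hw
    rw [Finset.mem_erase, Finset.mem_sdiff] at hw
    exact hb w hw.2.2 hw.1.symm
  · rw [Finset.card_erase_of_mem hzm, Finset.card_sdiff_of_subset (Finset.subset_univ C),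
      Finset.card_univ, smul_eq_mul]

theorem freePairs_T3 : freePairs 12 661 ≤ 98 ∧ freePoints 661 ≤ 5 := by decide +kernel

/-- The pairs allowed when at least two outer vertices have neighbours `0, 2, 4, 7, 9`. -/
theorem chords_count : (sumBelow 12 fun i => sumBelow 12 fun j =>
    (!(i == j || (cycBit 12 661 (i + 1) && cycBit 12 661 (j + 1)) ||
      (cycBit 12 661 (i + 11) && cycBit 12 661 (j + 11)) ||
      (i == 5 && (j == 9 || j == 0 || j == 11)) || (j == 5 && (i == 9 || i == 0 || i == 11)) ||
      (i == 6 && j == 10) || (j == 6 && i == 10))).toNat) ≤ 90 := by decide +kernel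

theorem twelve_special (hfree : twoP7.Free G) (hconn : G.Connected)
    (hcard : 14 ≤ Fintype.card V) (hc : CycMap G 12 c) (hC : ∀ v, v ∈ C ↔ ∃ i, c i = v)
    (h5 : ∀ z, z ∉ C → degIn G C z ≤ 5) {z : V} (hz : z ∉ C)
    (hN : ∀ i : ℕ, i < 12 → (G.Adj z (c i) ↔ Nat.testBit 661 i = true)) :
    G.edgeFinset.card ≤ 5 * Fintype.card V - 15 ∨
      G.edgeFinset.card ≤ 4 * Fintype.card V + 7 := by
  have hmax : ∀ c', ¬ CycMap G (12 + 1) c' := fun c' h => by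
    have := h.length_lt hfree hconn hcard; omega
  have hz' : ∀ i, c i ≠ z := fun i h => hz ((hC z).2 ⟨i, h⟩)
  have hmask : ∀ w, (∀ i : ℕ, i < 12 → (G.Adj w (c i) ↔ Nat.testBit 661 i = true)) →
      nbrMask G 12 c w = 661 := by
    intro w hw
    refine Nat.eq_of_testBit_eq fun i => ?_
    rcases Nat.lt_or_ge i 12 with hi | hi
    · rw [nbrMask, Nat.testBit_ofBits_lt _ _ hi]
      have := hw i hi
      rw [Bool.eq_iff_iff, decide_eq_true_iff]; exact this
    · rw [Nat.testBit_lt_two_pow (lt_of_lt_of_le (nbrMask_lt w) (Nat.pow_le_pow_right (by norm_num) hi)),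
        Nat.testBit_lt_two_pow (lt_of_lt_of_le (by norm_num) (Nat.pow_le_pow_right (by norm_num) hi))]
  have hcount := twelve_two_mul_card hfree hconn hc hC
  have hz5 := h5 z hz
  have hpairs := hc.adjSum_le_freePairs (by norm_num) hmax hz' hC
  have hCcard := hc.card_eq hC (by norm_num)
  rw [hmask z hN] at hpairs
  by_cases hex : ∃ w, w ∉ C ∧ z ≠ w ∧ 5 ≤ degIn G C w
  · obtain ⟨w, hw, hzw, hw5⟩ := hex
    have hw' : ∀ i, c i ≠ w := fun i h => hw ((hC w).2 ⟨i, h⟩)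
    have hbits : ∀ i < 12, Nat.testBit 661 ((i + 1) % 12) = false →
        Nat.testBit 661 ((i + 11) % 12) = false → Nat.testBit 661 ((i + 6) % 12) = false →
        Nat.testBit 661 i = true := by decide
    have hsub : ∀ i ∈ Finset.range 12, (cycBit 12 (nbrMask G 12 c w) i).toNat ≤
        (Nat.testBit 661 i).toNat := by
      intro i hi
      rw [hc.cycBit_nbrMask (by norm_num)]
      by_cases h : G.Adj w (c i)
      · have h1 : ¬ G.Adj z (c ((i + 1 : ℕ) : ℤ)) := fun h' =>
          hc.twelve_not_adj_succ hfree hw' hz' hzw.symm h (by exact_mod_cast h')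
        have h2 : ¬ G.Adj z (c ((i + 11 : ℕ) : ℤ)) := fun h' => by
          refine hc.twelve_not_adj_succ hfree hz' hw' hzw h' ?_
          rwa [show ((i + 11 : ℕ) : ℤ) + 1 = (i : ℤ) + (12 : ℕ) by push_cast; ring, hc.add_period]
        have h3 : ¬ G.Adj z (c ((i + 6 : ℕ) : ℤ)) := fun h' =>
          hc.twelve_not_adj_add_six hfree hw' hz' hzw.symm h (by exact_mod_cast h')
        have g : ∀ j : ℕ, ¬ G.Adj z (c j) → Nat.testBit 661 (j % 12) = false := by
          intro j hj
          rw [← Bool.not_eq_true, ← hN _ (Nat.mod_lt _ (by norm_num))]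
          have := hc.emod_eq j
          rw [← this] at hj
          exact_mod_cast hj
        have g1 := g _ h1
        have g2 := g _ h2
        have g3 := g _ h3
        have hi12 := Finset.mem_range.1 hi
        rw [hbits i hi12 g1 g2 g3]
        exact Bool.toNat_le _
      · simp [h]
    have hNw : ∀ i : ℕ, i < 12 → (G.Adj w (c i) ↔ Nat.testBit 661 i = true) := by
      have hle := Finset.sum_le_sum hsub
      rw [hc.degIn_eq hC (by norm_num), maskCard, sumBelow_eq] at hw5
      have h661 : ∑ i ∈ Finset.range 12, (Nat.testBit 661 i).toNat = 5 := by decide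
      have heq := (Finset.sum_eq_sum_iff_of_le hsub).1 (by omega)
      intro i hi
      have := heq i (Finset.mem_range.2 hi)
      rw [hc.cycBit_nbrMask (by norm_num)] at this
      rw [← Bool.toNat_eq_one, ← this]; simp
    have a : ∀ (x : V), (∀ i : ℕ, i < 12 → (G.Adj x (c i) ↔ Nat.testBit 661 i = true)) →
        G.Adj x (c 0) ∧ G.Adj x (c 2) ∧ G.Adj x (c 4) ∧ G.Adj x (c 7) ∧ G.Adj x (c 9) :=
      fun x hx => ⟨(hx 0 (by norm_num)).2 (by decide), (hx 2 (by norm_num)).2 (by decide),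
        (hx 4 (by norm_num)).2 (by decide), (hx 7 (by norm_num)).2 (by decide),
        (hx 9 (by norm_num)).2 (by decide)⟩
    obtain ⟨a0, a2, a4, a7, a9⟩ := a z hN
    obtain ⟨-, -, b4, b7, b9⟩ := a w hNw
    obtain ⟨n1, n2, n3, n4⟩ := twelve_no_chords hfree hc hz' hw' hzw a0 a2 a4 a7 b4 b7 b9
    have h90 : adjSum G C C ≤ 90 := by
      refine le_trans ?_ chords_count
      rw [hc.adjSum_eq hC (by norm_num), sumBelow_eq, sumBelow_eq]
      refine Finset.sum_le_sum fun i _ => ?_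
      rw [sumBelow_eq, sumBelow_eq]
      refine Finset.sum_le_sum fun j _ => ?_
      have hp := hc.pair_le_free (by norm_num) hmax hz' i j
      rw [hmask z hN] at hp
      by_cases h : G.Adj (c i) (c j)
      · have m1 : (i == 5 && (j == 9 || j == 0 || j == 11)) = false := by
          rw [← Bool.not_eq_true]
          simp only [Bool.and_eq_true, Bool.or_eq_true, beq_iff_eq]
          rintro ⟨rfl, (rfl | rfl) | rfl⟩
          exacts [n1 h, n2 h, n3 h]
        have m2 : (j == 5 && (i == 9 || i == 0 || i == 11)) = false := by
          rw [← Bool.not_eq_true]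
          simp only [Bool.and_eq_true, Bool.or_eq_true, beq_iff_eq]
          rintro ⟨rfl, (rfl | rfl) | rfl⟩
          exacts [n1 h.symm, n2 h.symm, n3 h.symm]
        have m3 : (i == 6 && j == 10) = false := by
          rw [← Bool.not_eq_true]
          simp only [Bool.and_eq_true, beq_iff_eq]
          rintro ⟨rfl, rfl⟩
          exact n4 h
        have m4 : (j == 6 && i == 10) = false := by
          rw [← Bool.not_eq_true]
          simp only [Bool.and_eq_true, beq_iff_eq]
          rintro ⟨rfl, rfl⟩
          exact n4 h.symm
        rw [m1, m2, m3, m4, Bool.or_false, Bool.or_false, Bool.or_false, Bool.or_false]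
        exact hp
      · rw [if_neg h]; exact Nat.zero_le _
    have hs : ∑ w ∈ Finset.univ \ C, degIn G C w ≤ (Finset.univ \ C).card • 5 :=
      Finset.sum_le_card_nsmul _ _ _ fun w hw => h5 w (Finset.mem_sdiff.1 hw).2
    rw [Finset.card_sdiff_of_subset (Finset.subset_univ C), Finset.card_univ, hCcard,
      smul_eq_mul] at hs
    omega
  · push Not at hex
    have hs := sum_degIn_le (G := G) hz (b := 4) fun w hw hzw => by
      have := hex w hw hzw; omega
    have := freePairs_T3.1
    rw [hCcard] at hs
    omega

theorem lt_of_twelve (hfree : twoP7.Free G) (hconn : G.Connected)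
    (hcard : 14 ≤ Fintype.card V) (hc : CycMap G 12 c) :
    G.edgeFinset.card < max (pathBracket (Fintype.card V) 14 7) (5 * Fintype.card V - 14) := by
  obtain ⟨C, hC⟩ : ∃ C : Finset V, ∀ v, v ∈ C ↔ ∃ i, c i = v :=
    ⟨(Set.range c).toFinite.toFinset, fun v => by simp⟩
  have hmax : ∀ c', ¬ CycMap G (12 + 1) c' := fun c' h => by
    have := h.length_lt hfree hconn hcard; omega
  have hCcard := hc.card_eq hC (by norm_num)
  have hZcard : (Finset.univ \ C).card = Fintype.card V - 12 := by
    rw [Finset.card_sdiff_of_subset (Finset.subset_univ C), Finset.card_univ, hCcard]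
  obtain ⟨z, hz, hzmax⟩ := (Finset.univ \ C).exists_max_image (degIn G C)
    (Finset.card_pos.1 (by omega))
  replace hz := (Finset.mem_sdiff.1 hz).2
  replace hzmax : ∀ w, w ∉ C → degIn G C w ≤ degIn G C z := fun w hw => hzmax w (by simpa using hw)
  have hz' : ∀ i, c i ≠ z := fun i h => hz ((hC z).2 ⟨i, h⟩)
  have hcount := twelve_two_mul_card hfree hconn hc hC
  have hpairs := hc.adjSum_le_freePairs (by norm_num) hmax hz' hC
  have hpts : ∀ w, w ∉ C → z ≠ w → degIn G C w ≤ freePoints (nbrMask G 12 c z) :=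
    fun w hw hzw => degIn_le_freePoints hfree hc hC hz hw hzw
  have hs := sum_degIn_le hz (b := degIn G C z) fun w hw _ => hzmax w hw
  have hs' := sum_degIn_le hz hpts
  have hself := adjSum_self_le (G := G) C
  rw [hCcard] at hs hs' hself
  have hm := allBelow_iff.1 mask_twelve _ (nbrMask_lt (G := G) (k := 12) (c := c) z)
  rw [hc.sparse_nbrMask (by norm_num) hmax hz', ← hc.degIn_eq hC (by norm_num)] at hm
  generalize hd : degIn G C z = d at *
  have hd7 : d < 7 := by
    by_contra! h7
    obtain ⟨e, rfl⟩ : ∃ e, d = e + 7 := ⟨d - 7, by omega⟩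
    simp at hm
  apply lt_bound hcard
  interval_cases d
  · omega
  · omega
  · omega
  · simp only [Bool.not_true, Bool.false_or, decide_eq_true_iff] at hm
    omega
  · simp only [Bool.not_true, Bool.false_or, Bool.or_eq_true, Bool.and_eq_true,
      decide_eq_true_iff] at hm
    rcases hm with hm | ⟨hm, hm'⟩
    · omega
    · have : (Fintype.card V - 12 - 1) * freePoints (nbrMask G 12 c z) ≤
        (Fintype.card V - 12 - 1) * 3 := Nat.mul_le_mul_left _ hm'
      omega
  · simp only [Bool.not_true, Bool.false_or, Bool.or_eq_true, Bool.and_eq_true,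
      decide_eq_true_iff] at hm
    rcases hm with ⟨hm, hm'⟩ | hm
    · have : (Fintype.card V - 12 - 1) * freePoints (nbrMask G 12 c z) ≤
        (Fintype.card V - 12 - 1) * 3 := Nat.mul_le_mul_left _ hm'
      omega
    · obtain ⟨t, ht⟩ := hc.exists_translate (by norm_num) hm
      refine (twelve_special hfree hconn hcard (hc.rotate t) (C := C) (fun v => ?_) hzmax hz ht).imp
        id fun h => Or.inr (Or.inl h)
      rw [hC]
      exact ⟨fun ⟨i, hi⟩ => ⟨i - t, by simpa using hi⟩, fun ⟨i, hi⟩ => ⟨_, hi⟩⟩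
  · simp only [Bool.not_true, Bool.false_or, Bool.and_eq_true,
      decide_eq_true_iff] at hm
    rw [hm.2, mul_zero] at hs'
    omega

end count

end CycMap
end

/-! ### Recognizing the extremal graph -/

section
variable {V : Type*} {G : SimpleGraph V}

theorem nonempty_iso_extremalGraph [Fintype V] [DecidableEq V] {n : ℕ} (hn : Fintype.card V = n)
    {X : Finset V} (hX : X.card = 5) {a b : V} (ha : a ∉ X) (hb : b ∉ X) (hab : a ≠ b)
    (hadj : ∀ u v, G.Adj u v ↔ u ≠ v ∧ (u ∈ X ∨ v ∈ X ∨ (u = a ∧ v = b) ∨ (u = b ∧ v = a))) :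
    Nonempty (G ≃g extremalGraph n) := by
  have hY : (insert a (insert b X)).card = 7 := by
    rw [Finset.card_insert_of_notMem (by simp [ha, hab]), Finset.card_insert_of_notMem hb, hX]
  have hn7 : 7 ≤ n := by rw [← hn, ← hY]; exact Finset.card_le_univ _
  have hR : (insert a (insert b X))ᶜ.card = n - 7 := by rw [Finset.card_compl, hY, hn]
  let e := (X.equivFinOfCardEq hX).symm
  let r := ((insert a (insert b X))ᶜ.equivFinOfCardEq hR).symm
  have hr : ∀ i, (r i).1 ≠ a ∧ (r i).1 ≠ b ∧ (r i).1 ∉ X := fun i => by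
    have := (r i).2
    simpa only [Finset.mem_compl, Finset.mem_insert, not_or] using this
  have he : ∀ i, (e i).1 ∈ X := fun i => (e i).2
  have hea : ∀ i, (e i).1 ≠ a := fun i h => ha (h ▸ he i)
  have heb : ∀ i, (e i).1 ≠ b := fun i h => hb (h ▸ he i)
  have her : ∀ i j, (e i).1 ≠ (r j).1 := fun i j h => (hr j).2.2 (h ▸ he i)
  let φ : Fin 5 ⊕ (Fin (n - 7) ⊕ Fin 2) → V :=
    Sum.elim (fun i => (e i).1) (Sum.elim (fun i => (r i).1) ![a, b])
  have hφ : Function.Injective φ := by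
    rintro (i | i | i) (j | j | j) h
    · have : e i = e j := Subtype.ext h
      rw [e.injective this]
    · exact (her i j h).elim
    · fin_cases j
      · exact (hea i h).elim
      · exact (heb i h).elim
    · exact (her j i h.symm).elim
    · have : r i = r j := Subtype.ext h
      rw [r.injective this]
    · fin_cases j
      · exact ((hr i).1 h).elim
      · exact ((hr i).2.1 h).elim
    · fin_cases i
      · exact (hea j h.symm).elim
      · exact (heb j h.symm).elim
    · fin_cases i
      · exact ((hr j).1 h.symm).elim
      · exact ((hr j).2.1 h.symm).elim
    · fin_cases i <;> fin_cases j <;> first | rfl | exact (hab h).elim | exact (hab h.symm).elim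
  have hbij : Function.Bijective φ := by
    rw [Fintype.bijective_iff_injective_and_card]
    refine ⟨hφ, ?_⟩
    simp only [Fintype.card_sum, Fintype.card_fin]
    omega
  refine ⟨RelIso.symm ⟨Equiv.ofBijective φ hbij, ?_⟩⟩
  intro x y
  rw [Equiv.ofBijective_apply, Equiv.ofBijective_apply, hadj, hφ.ne_iff]
  rcases x with i | i | i <;> rcases y with j | j | j
  · simp [φ, he, extremalGraph, graphJoin]
  · simp [φ, he, extremalGraph, graphJoin]
  · simp [φ, he, extremalGraph, graphJoin]
  · simp [φ, he, extremalGraph, graphJoin]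
  · simp [φ, hr, extremalGraph, graphJoin]
  · fin_cases j <;> simp [φ, hr, ha, hb, extremalGraph, graphJoin]
  · simp [φ, he, extremalGraph, graphJoin]
  · fin_cases i <;> simp [φ, hr, ha, hb, extremalGraph, graphJoin]
  · fin_cases i <;> fin_cases j <;> simp [φ, extremalGraph, graphJoin, ha, hb, hab]

/-! ### Graphs whose longest cycles have length eleven -/

theorem degIn_le_one [DecidableRel G.Adj] {S : Finset V} {z : V}
    (h : ∀ y ∈ S, ∀ y' ∈ S, G.Adj z y → G.Adj z y' → y = y') : degIn G S z ≤ 1 := by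
  rw [degIn, ← Finset.card_filter, Finset.card_le_one]
  intro y hy y' hy'
  rw [Finset.mem_filter] at hy hy'
  exact h y hy.1 y' hy'.1 hy.2 hy'.2

theorem degIn_eq_zero [DecidableRel G.Adj] {S : Finset V} {z : V} :
    degIn G S z = 0 ↔ ∀ y ∈ S, ¬ G.Adj z y := by
  rw [degIn, Finset.sum_eq_zero_iff]
  simp

namespace CycMap
variable {k : ℕ} {c : ℤ → V}

theorem exists_detour (hc : CycMap G k c) {q : List V} (hq : IsPathList G q)
    (hd : ∀ v ∈ q, ∀ i, c i ≠ v) {i : ℤ} {m : ℕ} (hm0 : 0 < m) (hm : m ≤ k) (hq0 : q ≠ [])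
    (hh : ∀ x ∈ q.head?, G.Adj x (c i)) (hl : ∀ x ∈ q.getLast?, G.Adj x (c (i + m))) :
    ∃ c', CycMap G (q.length + (k + 1 - m)) c' := by
  refine hc.exists_replace_arc hq hd (i := i + m) (j := i + k) (by omega) (by omega) (by omega) hl
    ?_ hq0
  rwa [hc.add_period]

theorem freePairs_eleven : freePairs 11 341 ≤ 82 ∧ ∀ i < 11, ∀ j < 11,
    (!(i == j || (cycBit 11 341 (i + 1) && cycBit 11 341 (j + 1)) ||
    (cycBit 11 341 (i + (11 - 1)) && cycBit 11 341 (j + (11 - 1))))) = true ↔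
    i ≠ j ∧ (Nat.testBit 341 i = true ∨ Nat.testBit 341 j = true ∨ (i = 9 ∧ j = 10) ∨
      (i = 10 ∧ j = 9)) := by decide +kernel

section eleven
variable [Fintype V] [DecidableEq V] [DecidableRel G.Adj] {C : Finset V}

omit [Fintype V] [DecidableEq V] [DecidableRel G.Adj] in
/-- A path of three outer vertices cannot leave a cycle of length eleven. -/
theorem eleven_no_three (hfree : twoP7.Free G) (hc : CycMap G 11 c)
    (hC : ∀ v, v ∈ C ↔ ∃ i, c i = v) {z y u : V} (hz : z ∉ C) (hy : y ∉ C) (hu : u ∉ C)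
    (hatt : ∃ i, G.Adj z (c i)) (hzy : G.Adj z y) (hyu : G.Adj y u) : u = z := by
  by_contra huz
  obtain ⟨i, hi⟩ := hatt
  have hp : IsPathList G [u, y, z] :=
    ⟨by simp [hzy.symm, hyu.symm], by simp [hyu.ne.symm, hzy.ne.symm, huz]⟩
  have := (hc.isPathList_append_arc hp (i := i) (by
    intro v hv j hj
    have hvC : v ∈ C := (hC v).2 ⟨j, hj⟩
    simp only [List.mem_cons, List.not_mem_nil, or_false] at hv
    rcases hv with rfl | rfl | rfl
    exacts [hu hvC, hy hvC, hz hvC]) le_rfl (by simpa using hi)).length_le hfree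
  simp at this

variable (hfree : twoP7.Free G) (hconn : G.Connected) (hc : CycMap G 11 c)
    (hC : ∀ v, v ∈ C ↔ ∃ i, c i = v)
include hfree hconn hc hC

omit [Fintype V] [DecidableEq V] [DecidableRel G.Adj] in
theorem eleven_exists_attached {u : V} (hu : u ∉ C) (hun : ¬ ∃ i, G.Adj u (c i)) :
    ∃ z, z ∉ C ∧ (∃ i, G.Adj z (c i)) ∧ G.Adj u z := by
  by_contra hno
  obtain ⟨x, y, hx, hy, hxy⟩ := exists_boundary_adj hconn
    (A := {v | v ∈ C ∨ (∃ i, G.Adj v (c i)) ∨ ∃ z, z ∉ C ∧ (∃ i, G.Adj z (c i)) ∧ G.Adj v z})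
    (x := c 0) (y := u) (Or.inl ((hC _).2 ⟨0, rfl⟩)) (by
      rintro (h | h | h); exacts [hu h, hun h, hno h])
  simp only [Set.mem_ofPred_eq, not_or] at hx hy
  by_cases hxC : x ∈ C
  · obtain ⟨i, rfl⟩ := (hC x).1 hxC
    exact hy.2.1 ⟨i, hxy.symm⟩
  by_cases hxa : ∃ i, G.Adj x (c i)
  · exact hy.2.2 ⟨x, hxC, hxa, hxy.symm⟩
  · obtain ⟨z, hz, hza, hxz⟩ := (hx.resolve_left hxC).resolve_left hxa
    have := eleven_no_three hfree hc hC hz hxC hy.1 hza hxz.symm hxy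
    exact hy.2.1 (this ▸ hza)

/-- The edges of a graph with a cycle of length eleven, counted twice; `A` is the set of outer
vertices with a neighbour on the cycle. -/
theorem eleven_two_mul_card {A : Finset V}
    (hA : ∀ v, v ∈ A ↔ v ∉ C ∧ ∃ i, G.Adj v (c i)) :
    2 * G.edgeFinset.card ≤ adjSum G C C + ∑ z ∈ A, (2 * degIn G C z + degIn G A z) +
      2 * ((Finset.univ \ C) \ A).card := by
  have hAZ : A ⊆ Finset.univ \ C := fun v hv => by simpa using ((hA v).1 hv).1
  have hU : ∀ u, u ∈ (Finset.univ \ C) \ A → u ∉ C ∧ ¬ ∃ i, G.Adj u (c i) := by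
    intro u hu
    simp only [Finset.mem_sdiff, Finset.mem_univ, true_and, hA, not_and] at hu
    exact ⟨hu.1, hu.2 hu.1⟩
  have h1 : adjSum G ((Finset.univ \ C) \ A) ((Finset.univ \ C) \ A) = 0 := by
    refine adjSum_eq_zero fun x hx y hy hxy => ?_
    obtain ⟨z, hz, hza, hxz⟩ := eleven_exists_attached hfree hconn hc hC (hU x hx).1 (hU x hx).2
    have := eleven_no_three hfree hc hC hz (hU x hx).1 (hU y hy).1 hza hxz.symm hxy
    exact (hU y hy).2 (this ▸ hza)
  have h2 : adjSum G ((Finset.univ \ C) \ A) A ≤ ((Finset.univ \ C) \ A).card := by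
    rw [adjSum_eq_sum_degIn]
    refine (Finset.sum_le_card_nsmul _ _ 1 fun u hu => ?_).trans (by simp)
    refine degIn_le_one fun y hy y' hy' h h' => ?_
    rw [hA] at hy hy'
    exact (eleven_no_three hfree hc hC hy.1 (hU u hu).1 hy'.1 hy.2 h.symm h').symm
  have h3 : adjSum G ((Finset.univ \ C) \ A) C = 0 := by
    refine adjSum_eq_zero fun x hx y hy hxy => ?_
    obtain ⟨i, rfl⟩ := (hC y).1 hy
    exact (hU x hx).2 ⟨i, hxy⟩
  have h4 : adjSum G (Finset.univ \ C) C = ∑ z ∈ A, degIn G C z := by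
    rw [← Finset.union_sdiff_of_subset hAZ, adjSum_union_left Finset.disjoint_sdiff, h3]
    rfl
  rw [← adjSum_univ, adjSum_sdiff_self (Finset.subset_univ C), adjSum_sdiff_self hAZ, h1, h4,
    Finset.sum_add_distrib, ← Finset.mul_sum, adjSum_eq_sum_degIn A A]
  omega

omit hconn [Fintype V] [DecidableEq V] in
theorem eleven_degIn_le_one {A : Finset V}
    (hA : ∀ v, v ∈ A ↔ v ∉ C ∧ ∃ i, G.Adj v (c i)) {z : V} (hz : z ∈ A) : degIn G A z ≤ 1 := by
  refine degIn_le_one fun y hy y' hy' h h' => ?_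
  rw [hA] at hy hy' hz
  by_contra hne
  have := eleven_no_three hfree hc hC hy.1 hz.1 hy'.1 hy.2 h.symm h'
  exact hne this.symm

omit hfree hconn [Fintype V] [DecidableEq V] [DecidableRel G.Adj] in
/-- Adjacent outer vertices have no neighbours at distance one or two. -/
theorem eleven_not_near (hmax : ∀ k c', 12 ≤ k → ¬ CycMap G k c') {z y : V} (hz : z ∉ C)
    (hy : y ∉ C) (hzy : G.Adj z y) {i : ℤ} (h : G.Adj z (c i)) :
    ¬ G.Adj y (c (i + 1)) ∧ ¬ G.Adj y (c (i + 2)) := by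
  have key : ∀ m : ℕ, 0 < m → m ≤ 2 → ¬ G.Adj y (c (i + m)) := by
    intro m hm0 hm2 h'
    obtain ⟨c', h⟩ := hc.exists_detour (isPathList_pair hzy) (i := i) (m := m) (by
      intro v hv j hj
      have hvC : v ∈ C := (hC v).2 ⟨j, hj⟩
      simp only [List.mem_cons, List.not_mem_nil, or_false] at hv
      rcases hv with rfl | rfl
      exacts [hz hvC, hy hvC]) hm0 (by omega) (by simp) (by simpa using h) (by simpa using h')
    refine hmax _ _ ?_ h
    simp; omega
  exact ⟨by simpa using key 1, by simpa using key 2⟩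

omit hfree hconn [Fintype V] [DecidableEq V] in
theorem eleven_isolated (hmax : ∀ k c', 12 ≤ k → ¬ CycMap G k c') {z y : V} (hz : z ∉ C)
    (hy : y ∉ C) (hT : isTranslate 11 341 (nbrMask G 11 c z) = true) (hya : ∃ i, G.Adj y (c i)) :
    ¬ G.Adj z y := by
  intro hzy
  obtain ⟨t, ht⟩ := hc.exists_translate (by norm_num) hT
  obtain ⟨i, hi⟩ := hya
  obtain ⟨s, hs, hsi⟩ := hc.exists_eq (by norm_num) t i
  rw [← hsi, add_comm] at hi
  have hset : Nat.testBit 341 s = true ∧ s + 2 < 11 ∧ Nat.testBit 341 (s + 2) = true ∨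
      2 ≤ s ∧ Nat.testBit 341 (s - 2) = true ∨ 1 ≤ s ∧ Nat.testBit 341 (s - 1) = true := by
    revert hs; clear * -; revert s; decide
  rcases hset with ⟨-, h1, h2⟩ | ⟨h1, h2⟩ | ⟨h1, h2⟩
  · rw [← ht _ h1] at h2
    refine (eleven_not_near hc hC hmax hy hz hzy.symm hi).2 ?_
    push_cast at h2
    rwa [show (s : ℤ) + 2 + t = s + t + 2 by ring] at h2
  · rw [← ht _ (by omega)] at h2
    refine (eleven_not_near hc hC hmax hz hy hzy h2).2 ?_
    rwa [show ((s - 2 : ℕ) : ℤ) + t + 2 = s + t by omega]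
  · rw [← ht _ (by omega)] at h2
    refine (eleven_not_near hc hC hmax hz hy hzy h2).1 ?_
    rwa [show ((s - 1 : ℕ) : ℤ) + t + 1 = s + t by omega]

omit hfree hconn [DecidableRel G.Adj] in
/-- A graph whose adjacencies along a cycle of length eleven and from the outer vertices are those
of the extremal graph. -/
theorem eleven_nonempty_iso
    (hCC : ∀ i < 11, ∀ j < 11, G.Adj (c (i : ℕ)) (c (j : ℕ)) ↔
      i ≠ j ∧ (Nat.testBit 341 i = true ∨ Nat.testBit 341 j = true ∨ (i = 9 ∧ j = 10) ∨
      (i = 10 ∧ j = 9)))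
    (hZC : ∀ z, z ∉ C → ∀ i < 11, G.Adj z (c (i : ℕ)) ↔ Nat.testBit 341 i = true)
    (hZZ : ∀ z, z ∉ C → ∀ w, w ∉ C → ¬ G.Adj z w) :
    Nonempty (G ≃g extremalGraph (Fintype.card V)) := by
  have hinj : ∀ i < 11, ∀ j < 11, c (i : ℕ) = c (j : ℕ) ↔ i = j := by
    intro i hi j hj
    rw [hc.eq_iff]; omega
  have hpos : ∀ v ∈ C, ∃ i : ℕ, i < 11 ∧ c i = v := by
    intro v hv
    obtain ⟨j, rfl⟩ := (hC v).1 hv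
    obtain ⟨t, ht, h⟩ := hc.exists_eq (by norm_num) 0 j
    exact ⟨t, ht, by simpa using h⟩
  let I : Finset ℕ := {0, 2, 4, 6, 8}
  have hI : ∀ i < 11, i ∈ I ↔ Nat.testBit 341 i = true := by decide
  have hI11 : ∀ i ∈ I, i < 11 := by decide
  let X : Finset V := I.image fun i : ℕ => c i
  have hXC : ∀ v ∈ X, v ∈ C := by
    intro v hv
    obtain ⟨i, -, rfl⟩ := Finset.mem_image.1 hv
    exact (hC _).2 ⟨_, rfl⟩
  have hX : ∀ i < 11, c (i : ℕ) ∈ X ↔ Nat.testBit 341 i = true := by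
    intro i hi
    rw [← hI i hi, Finset.mem_image]
    refine ⟨?_, fun h => ⟨i, h, rfl⟩⟩
    rintro ⟨j, hj, h⟩
    rwa [← (hinj j (hI11 j hj) i hi).1 h]
  refine nonempty_iso_extremalGraph rfl (X := X) ?_ (a := c (9 : ℕ)) (b := c (10 : ℕ)) ?_ ?_ ?_ ?_
  · rw [Finset.card_image_of_injOn]
    · decide
    · intro i hi j hj h
      exact (hinj i (hI11 i hi) j (hI11 j hj)).1 h
  · rw [hX 9 (by norm_num)]; decide
  · rw [hX 10 (by norm_num)]; decide
  · rw [ne_eq, hinj 9 (by norm_num) 10 (by norm_num)]; norm_num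
  · have h9 : c (9 : ℕ) ∈ C := (hC _).2 ⟨_, rfl⟩
    have h10 : c (10 : ℕ) ∈ C := (hC _).2 ⟨_, rfl⟩
    intro u v
    by_cases hu : u ∈ C <;> by_cases hv : v ∈ C
    · obtain ⟨i, hi, rfl⟩ := hpos u hu
      obtain ⟨j, hj, rfl⟩ := hpos v hv
      rw [hCC i hi j hj, ne_eq, ne_eq, hinj i hi j hj, hX i hi, hX j hj, hinj i hi 9 (by norm_num),
        hinj i hi 10 (by norm_num), hinj j hj 9 (by norm_num), hinj j hj 10 (by norm_num)]
    · obtain ⟨i, hi, rfl⟩ := hpos u hu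
      rw [G.adj_comm, hZC v hv i hi, hX i hi]
      have h1 : c (i : ℕ) ≠ v := fun h => hv (h ▸ hu)
      have h2 : v ∉ X := fun h => hv (hXC v h)
      have h3 : v ≠ c (9 : ℕ) := fun h => hv (h ▸ h9)
      have h4 : v ≠ c (10 : ℕ) := fun h => hv (h ▸ h10)
      simp only [h1, h2, h3, h4, ne_eq, not_false_eq_true, and_false, or_false, true_and]
    · obtain ⟨i, hi, rfl⟩ := hpos v hv
      rw [hZC u hu i hi, hX i hi]
      have h1 : u ≠ c (i : ℕ) := fun h => hu (h ▸ hv)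
      have h2 : u ∉ X := fun h => hu (hXC u h)
      have h3 : u ≠ c (9 : ℕ) := fun h => hu (h ▸ h9)
      have h4 : u ≠ c (10 : ℕ) := fun h => hu (h ▸ h10)
      simp only [h1, h2, h3, h4, ne_eq, not_false_eq_true, false_and, or_false, true_and, false_or]
    · have h2 : u ∉ X := fun h => hu (hXC u h)
      have h2' : v ∉ X := fun h => hv (hXC v h)
      have h3 : u ≠ c (9 : ℕ) := fun h => hu (h ▸ h9)
      have h4 : u ≠ c (10 : ℕ) := fun h => hu (h ▸ h10)
      simp only [h2, h2', h3, h4, false_and, or_false, and_false, iff_false]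
      exact hZZ u hu v hv

omit hfree hconn in
theorem eleven_nonempty_iso_of_tight (hmax : ∀ k c', 12 ≤ k → ¬ CycMap G k c')
    (hCC : 82 ≤ adjSum G C C) (h5 : ∀ z, z ∉ C → degIn G C z = 5)
    (hZZ : ∀ z, z ∉ C → ∀ w, w ∉ C → ¬ G.Adj z w) {z : V} (hz : z ∉ C)
    (hN : ∀ i : ℕ, i < 11 → (G.Adj z (c i) ↔ Nat.testBit 341 i = true)) :
    Nonempty (G ≃g extremalGraph (Fintype.card V)) := by
  have hmax' : ∀ c', ¬ CycMap G (11 + 1) c' := fun c' => hmax 12 c' le_rfl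
  have hz' : ∀ i, c i ≠ z := fun i h => hz ((hC z).2 ⟨i, h⟩)
  have hmask : nbrMask G 11 c z = 341 := by
    refine Nat.eq_of_testBit_eq fun i => ?_
    rcases Nat.lt_or_ge i 11 with hi | hi
    · rw [nbrMask, Nat.testBit_ofBits_lt _ _ hi]
      have := hN i hi
      rw [Bool.eq_iff_iff, decide_eq_true_iff]; exact this
    · rw [Nat.testBit_lt_two_pow (lt_of_lt_of_le (nbrMask_lt z) (Nat.pow_le_pow_right (by norm_num) hi)),
        Nat.testBit_lt_two_pow (lt_of_lt_of_le (by norm_num) (Nat.pow_le_pow_right (by norm_num) hi))]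
  have hCC' : ∀ i < 11, ∀ j < 11, G.Adj (c (i : ℕ)) (c (j : ℕ)) ↔
      i ≠ j ∧ (Nat.testBit 341 i = true ∨ Nat.testBit 341 j = true ∨ (i = 9 ∧ j = 10) ∨
      (i = 10 ∧ j = 9)) := by
    have hle := fun i j => hc.pair_le_free (by norm_num) hmax' hz' i j
    rw [hmask] at hle
    have hle' : ∀ i ∈ Finset.range 11, _ := fun i _ =>
      Finset.sum_le_sum fun j (_ : j ∈ Finset.range 11) => hle i j
    have h82 := freePairs_eleven.1
    rw [freePairs, sumBelow_eq] at h82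
    simp only [sumBelow_eq] at h82
    rw [hc.adjSum_eq hC (by norm_num), sumBelow_eq] at hCC
    simp only [sumBelow_eq] at hCC
    have heq := (Finset.sum_eq_sum_iff_of_le hle').1
      (le_antisymm (Finset.sum_le_sum hle') (h82.trans hCC))
    intro i hi j hj
    have := (Finset.sum_eq_sum_iff_of_le fun j _ => hle i j).1 (heq i (Finset.mem_range.2 hi)) j
      (Finset.mem_range.2 hj)
    rw [← freePairs_eleven.2 i hi j hj, ← Bool.toNat_eq_one, ← this]
    split_ifs with h <;> simp [h]
  have hadj : ∀ i < 11, ∀ j < 11, Nat.testBit 341 i = true → i ≠ j →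
      G.Adj (c (i : ℕ)) (c (j : ℕ)) := fun i hi j hj h hij => (hCC' i hi j hj).2 ⟨hij, Or.inl h⟩
  refine eleven_nonempty_iso hc hC hCC' ?_ hZZ
  intro w hw
  have hw' : ∀ i, c i ≠ w := fun i h => hw ((hC w).2 ⟨i, h⟩)
  have hw5 := h5 w hw
  have hother : ∀ i : ℕ, ∃ j < 11, j ≠ i ∧ G.Adj w (c (j : ℕ)) := by
    intro i
    by_contra! hno
    have : degIn G C w ≤ 1 := by
      rw [degIn, hc.sum_eq hC (by norm_num)]
      refine (Finset.sum_le_sum (g := fun j => if j = i then 1 else 0) fun j hj => ?_).trans ?_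
      · by_cases h : G.Adj w (c (j : ℕ))
        · have : j = i := by
            by_contra hji
            exact hno j (Finset.mem_range.1 hj) hji h
          rw [if_pos this]
          split_ifs
          all_goals simp
        · simp [h]
      · rw [Finset.sum_ite_eq']; split_ifs <;> norm_num
    omega
  have hsub : ∀ i < 11, G.Adj w (c (i : ℕ)) → Nat.testBit 341 i = true := by
    intro i hi h
    by_contra hbit
    obtain ⟨j, hj, hji, h'⟩ := hother i
    have hcases : (i + 1 < 11 ∧ Nat.testBit 341 (i + 1) = true) ∨
        (1 ≤ i ∧ Nat.testBit 341 (i - 1) = true) ∨ i = 10 := by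
      revert hi hbit; clear * -; revert i; decide
    rcases hcases with ⟨h1, h2⟩ | ⟨h1, h2⟩ | rfl
    · refine hc.not_adj_succ_succ (by norm_num) hmax' hw' h h' ?_
      by_cases h10 : j = 10
      · subst h10
        have := hadj (i + 1) h1 0 (by norm_num) h2 (by omega)
        have e := hc.add_period 0
        norm_num at e this ⊢
        rwa [e]
      · exact_mod_cast hadj (i + 1) h1 (j + 1) (by omega) h2 (by omega)
    · refine hc.not_adj_pred_pred (by norm_num) hmax' hw' h h' ?_
      by_cases h0 : j = 0
      · subst h0
        have hi10 : i - 1 ≠ 10 := by omega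
        have := hadj (i - 1) (by omega) 10 (by norm_num) h2 hi10
        have e := hc.add_period (-1)
        push_cast [h1] at this
        norm_num at e ⊢
        rwa [← e]
      · have := hadj (i - 1) (by omega) (j - 1) (by omega) h2 (by omega)
        rwa [show ((i - 1 : ℕ) : ℤ) = i - 1 by omega, show ((j - 1 : ℕ) : ℤ) = j - 1 by omega]
          at this
    · refine hc.not_adj_succ_succ (by norm_num) hmax' hw' h h' ?_
      have := hadj 0 (by norm_num) (j + 1) (by omega) (by decide) (by omega)
      have e := hc.add_period 0
      norm_num at e this ⊢
      rwa [e]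
  have hle : ∀ i ∈ Finset.range 11, (if G.Adj w (c (i : ℕ)) then 1 else 0) ≤
      (Nat.testBit 341 i).toNat := by
    intro i hi
    by_cases h : G.Adj w (c (i : ℕ))
    · rw [hsub i (Finset.mem_range.1 hi) h]; simp [h]
    · simp [h]
  rw [degIn, hc.sum_eq hC (by norm_num)] at hw5
  have h341 : ∑ i ∈ Finset.range 11, (Nat.testBit 341 i).toNat = 5 := by decide
  have heq := (Finset.sum_eq_sum_iff_of_le hle).1 (by omega)
  intro i hi
  have := heq i (Finset.mem_range.2 hi)
  rw [← Bool.toNat_eq_one, ← this]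
  simp

theorem eleven_bound (hcard : 14 ≤ Fintype.card V) (hmax : ∀ k c', 12 ≤ k → ¬ CycMap G k c') :
    G.edgeFinset.card < max (pathBracket (Fintype.card V) 14 7) (5 * Fintype.card V - 14) ∨
    (G.edgeFinset.card ≤ 5 * Fintype.card V - 14 ∧
      (G.edgeFinset.card = 5 * Fintype.card V - 14 →
        Nonempty (G ≃g extremalGraph (Fintype.card V)))) := by
  have hmax' : ∀ c', ¬ CycMap G (11 + 1) c' := fun c' => hmax 12 c' le_rfl
  have hCcard := hc.card_eq hC (by norm_num)
  have hZcard : (Finset.univ \ C).card = Fintype.card V - 11 := by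
    rw [Finset.card_sdiff_of_subset (Finset.subset_univ C), Finset.card_univ, hCcard]
  obtain ⟨A, hA⟩ : ∃ A : Finset V, ∀ v, v ∈ A ↔ v ∉ C ∧ ∃ i, G.Adj v (c i) :=
    ⟨{v | v ∉ C ∧ ∃ i, G.Adj v (c i)}.toFinite.toFinset, fun v => by simp⟩
  have hAZ : A ⊆ Finset.univ \ C := fun v hv => by simpa using ((hA v).1 hv).1
  have hUcard := Finset.card_sdiff_add_card_eq_card hAZ
  obtain ⟨z, hz, hzmax⟩ := (Finset.univ \ C).exists_max_image (degIn G C)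
    (Finset.card_pos.1 (by omega))
  replace hz := (Finset.mem_sdiff.1 hz).2
  replace hzmax : ∀ w, w ∉ C → degIn G C w ≤ degIn G C z := fun w hw => hzmax w (by simpa using hw)
  have hz' : ∀ i, c i ≠ z := fun i h => hz ((hC z).2 ⟨i, h⟩)
  have hcount := eleven_two_mul_card hfree hconn hc hC hA
  have hpairs := hc.adjSum_le_freePairs (by norm_num) hmax' hz' hC
  have hself := adjSum_self_le (G := G) C
  rw [hCcard] at hself
  have hmask : ∀ w, w ∉ C → _ := fun w hw =>
    allBelow_iff.1 mask_eleven _ (nbrMask_lt (G := G) (k := 11) (c := c) w)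
  have hm := hmask z hz
  rw [hc.sparse_nbrMask (by norm_num) hmax' hz', ← hc.degIn_eq hC (by norm_num)] at hm
  have hsum : ∀ b, (∀ w ∈ A, 2 * degIn G C w + degIn G A w ≤ b) →
      ∑ w ∈ A, (2 * degIn G C w + degIn G A w) ≤ A.card * b := fun b hb => by
    simpa using Finset.sum_le_card_nsmul _ _ b hb
  have hA1 := fun w hw => eleven_degIn_le_one hfree hc hC hA (z := w) hw
  have hAC : ∀ w ∈ A, w ∉ C := fun w hw => ((hA w).1 hw).1
  generalize hd : degIn G C z = d at *
  have hd6 : d < 6 := by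
    by_contra! h6
    obtain ⟨e, rfl⟩ : ∃ e, d = e + 6 := ⟨d - 6, by omega⟩
    simp at hm
  by_cases hd3 : d ≤ 3
  · have := hsum 7 fun w hw => by have := hzmax w (hAC w hw); have := hA1 w hw; omega
    exact Or.inl (lt_bound hcard (by omega))
  obtain rfl | rfl : d = 4 ∨ d = 5 := by omega
  · simp only [Bool.not_true, Bool.false_or, decide_eq_true_iff] at hm
    have := hsum 9 fun w hw => by have := hzmax w (hAC w hw); have := hA1 w hw; omega
    exact Or.inl (lt_bound hcard (by omega))
  simp only [Bool.not_true, Bool.false_or, Bool.and_eq_true, decide_eq_true_iff] at hm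
  have htrans : ∀ w, w ∉ C → degIn G C w = 5 →
      isTranslate 11 341 (nbrMask G 11 c w) = true := by
    intro w hw h5
    have hmw := hmask w hw
    rw [hc.sparse_nbrMask (by norm_num) hmax' (fun i h => hw ((hC w).2 ⟨i, h⟩)),
      ← hc.degIn_eq hC (by norm_num), h5] at hmw
    simp only [Bool.not_true, Bool.false_or, Bool.and_eq_true] at hmw
    exact hmw.2
  have h10 : ∀ w ∈ A, 2 * degIn G C w + degIn G A w ≤ 10 ∧
      (2 * degIn G C w + degIn G A w = 10 → degIn G C w = 5 ∧ degIn G A w = 0) := by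
    intro w hw
    have h1 := hzmax w (hAC w hw)
    have h2 := hA1 w hw
    by_cases h5 : degIn G C w = 5
    · have h0 : degIn G A w = 0 := degIn_eq_zero.2 fun y hy =>
        eleven_isolated hc hC hmax (hAC w hw) (hAC y hy) (htrans w (hAC w hw) h5) ((hA y).1 hy).2
      omega
    · omega
  have hs10 := hsum 10 fun w hw => (h10 w hw).1
  right
  refine ⟨by omega, fun heq => ?_⟩
  have hUe : (Finset.univ \ C) \ A = ∅ := by
    rw [← Finset.card_eq_zero]; omega
  have hZA : ∀ w, w ∉ C → w ∈ A := by
    intro w hw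
    by_contra hwA
    have : w ∈ (Finset.univ \ C) \ A := by simp [hw, hwA]
    rw [hUe] at this
    simp at this
  have hsumeq : ∑ w ∈ A, (2 * degIn G C w + degIn G A w) = ∑ w ∈ A, 10 := by
    rw [Finset.sum_const, smul_eq_mul]; omega
  have hall := (Finset.sum_eq_sum_iff_of_le fun w hw => (h10 w hw).1).1 hsumeq
  obtain ⟨t, ht⟩ := hc.exists_translate (by norm_num) (htrans z hz hd)
  refine eleven_nonempty_iso_of_tight (hc.rotate t) (C := C) (fun v => ?_) hmax (by omega)
    (fun w hw => ((h10 w (hZA w hw)).2 (hall w (hZA w hw))).1)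
    (fun w hw y hy => degIn_eq_zero.1 ((h10 w (hZA w hw)).2 (hall w (hZA w hw))).2 y (hZA y hy))
    hz ht
  rw [hC]
  exact ⟨fun ⟨i, hi⟩ => ⟨i - t, by simpa using hi⟩, fun ⟨i, hi⟩ => ⟨_, hi⟩⟩

end eleven
end CycMap
end

/-! ### Dense vertex sets contain long cycles -/

section
variable {V : Type*} {G : SimpleGraph V} [DecidableEq V] [DecidableRel G.Adj]

/-- Every nonempty subset `U` of `T` meets more than `4 |U|` edges of the graph on `T`. -/
def DenseOn (G : SimpleGraph V) [DecidableRel G.Adj] (T : Finset V) : Prop :=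
  ∀ U ⊆ T, U.Nonempty → adjSum G (T \ U) (T \ U) + 8 * U.card < adjSum G T T

/-- `v 0, …, v (p - 1)` is a path of `G` inside `T`. -/
structure IsPathFn (G : SimpleGraph V) (T : Finset V) (p : ℕ) (v : ℕ → V) : Prop where
  mem : ∀ i < p, v i ∈ T
  inj : ∀ i < p, ∀ j < p, v i = v j → i = j
  adj : ∀ i, i + 1 < p → G.Adj (v i) (v (i + 1))

variable {T : Finset V}

/-- In a dense set, the closed neighbourhood of `U` is large compared to `U`. -/
theorem DenseOn.window (hT : DenseOn G T) {U W : Finset V} (hUT : U ⊆ T) (hUW : U ⊆ W)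
    (hU : U.Nonempty) (hN : ∀ u ∈ U, ∀ y ∈ T, G.Adj u y → y ∈ W) : U.card + 9 < 2 * W.card := by
  by_contra! hle
  have h1 := hT U hUT hU
  have h2 := adjSum_self_le (G := G) U
  have h3 : adjSum G U (T \ U) ≤ U.card * (W.card - U.card) := by
    rw [adjSum_eq_sum_degIn]
    refine (Finset.sum_le_card_nsmul _ _ (W.card - U.card) fun u hu => ?_).trans (by simp)
    rw [degIn, ← Finset.card_filter, ← Finset.card_sdiff_of_subset hUW]
    refine Finset.card_le_card fun y hy => ?_
    rw [Finset.mem_filter, Finset.mem_sdiff] at hy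
    exact Finset.mem_sdiff.2 ⟨hN u hu y hy.1.1 hy.2, hy.1.2⟩
  have h4 : adjSum G T T = adjSum G (T \ U) (T \ U) + 2 * adjSum G U (T \ U) + adjSum G U U := by
    rw [adjSum_sdiff_self hUT, adjSum_comm (T \ U) U]; ring
  have h5 := Finset.card_le_card hUW
  obtain ⟨d, hd⟩ := Nat.exists_eq_add_of_le h5
  rw [hd] at h3 hle
  rw [Nat.add_sub_cancel_left] at h3
  have h6 : 2 * d + U.card ≤ 9 := by omega
  nlinarith

theorem DenseOn.five_le_degIn (hT : DenseOn G T) {v : V} (hv : v ∈ T) : 5 ≤ degIn G T v := by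
  have := hT.window (U := {v}) (W := insert v (T.filter (G.Adj v))) (by simpa) (by simp) (by simp)
    (by
      intro u hu y hy h
      rw [Finset.mem_singleton] at hu
      subst hu
      simp [hy, h])
  have h2 := Finset.card_insert_le v (T.filter (G.Adj v))
  have h3 : degIn G T v = (T.filter (G.Adj v)).card := by rw [degIn, ← Finset.card_filter]
  rw [Finset.card_singleton] at this
  omega

namespace IsPathFn
variable {p : ℕ} {v : ℕ → V}

omit [DecidableEq V] [DecidableRel G.Adj] in
theorem isPathList (h : IsPathFn G T p v) : IsPathList G ((List.range p).map v) := by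
  constructor
  · rw [List.isChain_map, List.isChain_range]
    intro m hm
    exact h.adj m (by omega)
  · rw [List.nodup_map_iff_inj_on List.nodup_range]
    intro x hx y hy hxy
    rw [List.mem_range] at hx hy
    exact h.inj x hx y hy hxy

omit [DecidableEq V] [DecidableRel G.Adj] in
theorem exists_cycMap (h : IsPathFn G T p v) (hp : 0 < p) (hclose : G.Adj (v (p - 1)) (v 0)) :
    ∃ c, CycMap G p c ∧ ∀ i, c i ∈ T := by
  obtain ⟨c, hc, hmem⟩ := cycMap_of_list h.isPathList (by simpa) (by
    intro x hx y hy
    obtain ⟨q, rfl⟩ : ∃ q, p = q + 1 := ⟨p - 1, by omega⟩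
    have hx' : v q = x := by simpa [List.range_succ] using hx
    have hy' : v 0 = y := by simpa [List.range_succ_eq_map] using hy
    rw [← hx', ← hy']; simpa using hclose)
  refine ⟨c, by simpa using hc, fun i => ?_⟩
  obtain ⟨j, hj, hji⟩ := List.mem_map.1 (hmem i)
  rw [← hji]
  exact h.mem j (List.mem_range.1 hj)

omit [DecidableEq V] [DecidableRel G.Adj] in
theorem reverse (h : IsPathFn G T p v) : IsPathFn G T p fun t => v (p - 1 - t) where
  mem i hi := h.mem _ (by omega)
  inj i hi j hj hij := by
    have := h.inj _ (by omega) _ (by omega) hij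
    omega
  adj i hi := by
    have := (h.adj (p - 1 - (i + 1)) (by omega)).symm
    rwa [show p - 1 - (i + 1) + 1 = p - 1 - i by omega] at this

omit [DecidableEq V] [DecidableRel G.Adj] in
theorem rotate (h : IsPathFn G T p v) {i : ℕ} (hi : i < p) (hadj : G.Adj (v 0) (v i)) :
    IsPathFn G T p fun t => if t < i then v (i - 1 - t) else v t where
  mem t ht := by
    split_ifs
    · exact h.mem _ (by omega)
    · exact h.mem _ ht
  inj s hs t ht hst := by
    split_ifs at hst
    · have := h.inj _ (by omega) _ (by omega) hst
      omega
    · have := h.inj _ (by omega) _ (by omega) hst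
      omega
    · have := h.inj _ (by omega) _ (by omega) hst
      omega
    · exact h.inj _ hs _ ht hst
  adj t ht := by
    by_cases h1 : t + 1 < i
    · rw [if_pos (by omega), if_pos h1]
      have := (h.adj (i - 1 - (t + 1)) (by omega)).symm
      rwa [show i - 1 - (t + 1) + 1 = i - 1 - t by omega] at this
    · by_cases h2 : t + 1 = i
      · rw [if_pos (by omega), if_neg (by omega), show i - 1 - t = 0 by omega, h2]
        exact hadj
      · rw [if_neg (by omega), if_neg h1]
        exact h.adj t ht

omit [DecidableEq V] [DecidableRel G.Adj] in
theorem exists_eq_of_adj (h : IsPathFn G T p v) (hp : 0 < p) (hmax : ∀ v, ¬ IsPathFn G T (p + 1) v)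
    {y : V} (hy : y ∈ T) (hadj : G.Adj (v 0) y) : ∃ j < p, v j = y := by
  by_contra! hno
  refine hmax (fun t => if t = 0 then y else v (t - 1)) ⟨fun i hi => ?_, fun i hi j hj hij => ?_,
    fun i hi => ?_⟩
  · split_ifs
    · exact hy
    · exact h.mem _ (by omega)
  · split_ifs at hij with h1 h2 h2
    · omega
    · exact (hno _ (by omega) hij.symm).elim
    · exact (hno _ (by omega) hij).elim
    · have := h.inj _ (by omega) _ (by omega) hij
      omega
  · rw [if_neg (by omega : i + 1 ≠ 0)]
    split_ifs with h1
    · subst h1; exact hadj.symm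
    · have := h.adj (i - 1) (by omega)
      rwa [show i - 1 + 1 = i by omega] at this

variable (hT : DenseOn G T) (hp : 0 < p) (hmax : ∀ v, ¬ IsPathFn G T (p + 1) v)
include hT hp hmax

theorem five_le_card (h : IsPathFn G T p v) :
    5 ≤ ((Finset.range p).filter fun j => G.Adj (v 0) (v j)).card := by
  refine (hT.five_le_degIn (h.mem 0 hp)).trans ?_
  rw [degIn, ← Finset.card_filter]
  refine (Finset.card_le_card (t := ((Finset.range p).filter fun j => G.Adj (v 0) (v j)).image v)
    fun y hy => ?_).trans Finset.card_image_le
  rw [Finset.mem_filter] at hy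
  obtain ⟨j, hj, rfl⟩ := h.exists_eq_of_adj hp hmax hy.1 hy.2
  exact Finset.mem_image.2 ⟨j, by simp [hj, hy.2], rfl⟩

theorem five_le_card' (h : IsPathFn G T p v) :
    5 ≤ ((Finset.range p).filter fun j => G.Adj (v (p - 1)) (v j)).card := by
  refine (hT.five_le_degIn (h.mem (p - 1) (by omega))).trans ?_
  rw [degIn, ← Finset.card_filter]
  refine (Finset.card_le_card
    (t := ((Finset.range p).filter fun j => G.Adj (v (p - 1)) (v j)).image v)
    fun y hy => ?_).trans Finset.card_image_le
  rw [Finset.mem_filter] at hy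
  obtain ⟨j, hj, rfl⟩ := h.reverse.exists_eq_of_adj hp hmax hy.1 hy.2
  exact Finset.mem_image.2 ⟨p - 1 - j, by
    rw [Finset.mem_filter, Finset.mem_range]
    exact ⟨by omega, hy.2⟩, rfl⟩

/-- A cycle on the vertices of a longest path has at least ten vertices. -/
theorem ten_le_of_cycMap {c : ℤ → V} (hc : CycMap G p c) (hcT : ∀ i, c i ∈ T) : 10 ≤ p := by
  have hinj : ∀ a : ℤ, ∀ s < p, ∀ t < p, c (a + (s : ℕ)) = c (a + (t : ℕ)) → s = t := by
    intro a s hs t ht h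
    rw [hc.eq_iff] at h
    have h2 : |(a + s) - (a + t)| < (p : ℤ) := by rw [abs_lt]; constructor <;> omega
    have := Int.eq_zero_of_abs_lt_dvd h h2
    omega
  have hcard : ((Finset.range p).image fun s : ℕ => c (0 + (s : ℕ))).card = p := by
    rw [Finset.card_image_of_injOn, Finset.card_range]
    intro s hs t ht
    exact hinj 0 s (by simpa using hs) t (by simpa using ht)
  have := hT.window (U := (Finset.range p).image fun s : ℕ => c (0 + (s : ℕ)))
    (W := (Finset.range p).image fun s : ℕ => c (0 + (s : ℕ)))
    (fun y hy => by obtain ⟨s, -, rfl⟩ := Finset.mem_image.1 hy; exact hcT _) (subset_refl _)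
    (Finset.card_pos.1 (by omega)) (by
      intro u hu y hy huy
      obtain ⟨s, -, rfl⟩ := Finset.mem_image.1 hu
      have hpath : IsPathFn G T p fun t => c (s + (t : ℕ)) :=
        ⟨fun i _ => hcT _, hinj s, fun i _ => by
          have := hc.adj (s + i)
          push_cast
          rwa [add_assoc] at this⟩
      obtain ⟨j, -, rfl⟩ := hpath.exists_eq_of_adj hp hmax hy (by simpa using huy)
      obtain ⟨t, ht, h⟩ := hc.exists_eq hp 0 (s + j)
      exact Finset.mem_image.2 ⟨t, Finset.mem_range.2 ht, h⟩)
  rw [hcard] at this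
  omega

/-- A longest path whose end vertices have crossing neighbours gives a cycle of length at least
ten. -/
theorem exists_cycMap_of_crossing (h : IsPathFn G T p v) {i j : ℕ} (hij : i < j) (hj : j < p)
    (h1 : G.Adj (v 0) (v j)) (h2 : G.Adj (v (p - 1)) (v i)) :
    ∃ k c, 10 ≤ k ∧ CycMap G k c ∧ ∀ i, c i ∈ T := by
  obtain ⟨i, j, hij, hj, h1, h2, hmin⟩ : ∃ i j, i < j ∧ j < p ∧ G.Adj (v 0) (v j) ∧
      G.Adj (v (p - 1)) (v i) ∧ ∀ i' j', i' < j' → j' < p → G.Adj (v 0) (v j') →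
        G.Adj (v (p - 1)) (v i') → j - i ≤ j' - i' := by
    have hex : ∃ d, ∃ i j, i < j ∧ j < p ∧ G.Adj (v 0) (v j) ∧ G.Adj (v (p - 1)) (v i) ∧
        j - i = d := ⟨_, i, j, hij, hj, h1, h2, rfl⟩
    classical
    obtain ⟨a, b, hab, hb, h3, h4, h5⟩ := Nat.find_spec hex
    refine ⟨a, b, hab, hb, h3, h4, fun i' j' hi hj h6 h7 => ?_⟩
    rw [h5]
    exact Nat.find_min' hex ⟨i', j', hi, hj, h6, h7, rfl⟩
  have hpath : IsPathFn G T (i + 1 + (p - j)) fun t => if t ≤ i then v t else v (p + i - t) := by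
    refine ⟨fun t ht => ?_, fun s hs t ht hst => ?_, fun t ht => ?_⟩
    · split_ifs
      · exact h.mem _ (by omega)
      · exact h.mem _ (by omega)
    · split_ifs at hst <;>
      · have := h.inj _ (by omega) _ (by omega) hst
        omega
    · by_cases ht1 : t + 1 ≤ i
      · rw [if_pos (by omega), if_pos ht1]
        exact h.adj t (by omega)
      · by_cases ht2 : t = i
        · subst ht2
          rw [if_pos le_rfl, if_neg ht1, show p + t - (t + 1) = p - 1 by omega]
          exact h2.symm
        · rw [if_neg (by omega), if_neg ht1]
          have := (h.adj (p + i - (t + 1)) (by omega)).symm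
          rwa [show p + i - (t + 1) + 1 = p + i - t by omega] at this
  obtain ⟨c, hc, hcT⟩ := hpath.exists_cycMap (by omega) (by
    rw [if_pos (by omega : 0 ≤ i), if_neg (by omega),
      show p + i - (i + 1 + (p - j) - 1) = j by omega]
    exact h1.symm)
  refine ⟨_, c, ?_, hc, hcT⟩
  by_cases hd : j = i + 1
  · have hL : i + 1 + (p - j) = p := by omega
    rw [hL] at hc ⊢
    exact ten_le_of_cycMap hT hp hmax hc hcT
  · have hA := h.five_le_card hT hp hmax
    have hB := h.five_le_card' hT hp hmax
    set A := (Finset.range p).filter fun j => G.Adj (v 0) (v j) with hAdef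
    set B := (Finset.range p).filter fun j => G.Adj (v (p - 1)) (v j) with hBdef
    have hA' : ∀ x ∈ A, 0 < x ∧ x < p ∧ G.Adj (v 0) (v x) := by
      intro x hx
      rw [hAdef, Finset.mem_filter, Finset.mem_range] at hx
      refine ⟨Nat.pos_of_ne_zero ?_, hx⟩
      rintro rfl
      exact G.loopless.irrefl _ hx.2
    have hB' : ∀ x ∈ B, x + 1 < p ∧ G.Adj (v (p - 1)) (v x) := by
      intro x hx
      rw [hBdef, Finset.mem_filter, Finset.mem_range] at hx
      refine ⟨?_, hx.2⟩
      by_contra hx1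
      obtain rfl : x = p - 1 := by omega
      exact G.loopless.irrefl _ hx.2
    have hdisj : Disjoint A (B.image (· + 1)) := by
      rw [Finset.disjoint_left]
      intro x hx hx'
      obtain ⟨y, hy, rfl⟩ := Finset.mem_image.1 hx'
      have := hmin y (y + 1) (by omega) (hB' y hy).1 (hA' _ hx).2.2 (hB' y hy).2
      omega
    have hsub : A ∪ B.image (· + 1) ⊆ Finset.Icc 1 (i + 1) ∪ Finset.Ico j p := by
      intro x hx
      rw [Finset.mem_union, Finset.mem_Icc, Finset.mem_Ico]
      rcases Finset.mem_union.1 hx with hx | hx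
      · obtain ⟨h3, h4, h5⟩ := hA' x hx
        by_contra hno
        have := hmin i x (by omega) h4 h5 h2
        omega
      · obtain ⟨y, hy, rfl⟩ := Finset.mem_image.1 hx
        obtain ⟨h3, h4⟩ := hB' y hy
        by_contra hno
        have := hmin y j (by omega) hj h1 h4
        omega
    have hc1 := (Finset.card_le_card hsub).trans (Finset.card_union_le _ _)
    rw [Finset.card_union_of_disjoint hdisj,
      Finset.card_image_of_injective _ (add_left_injective 1), Nat.card_Icc, Nat.card_Ico] at hc1
    omega

/-- Some longest path of at most thirteen vertices has crossing neighbours of its end vertices. -/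
theorem exists_crossing (hp13 : p ≤ 13) (h : IsPathFn G T p v) :
    ∃ v i j, IsPathFn G T p v ∧ i < j ∧ j < p ∧ G.Adj (v 0) (v j) ∧ G.Adj (v (p - 1)) (v i) := by
  by_contra! hno
  obtain ⟨a, ⟨v, h, hap, hva⟩, hmaxa⟩ : ∃ a, (∃ v, IsPathFn G T p v ∧ a < p ∧ G.Adj (v 0) (v a)) ∧
      ∀ b v, IsPathFn G T p v → b < p → G.Adj (v 0) (v b) → b ≤ a := by
    classical
    have hne := Finset.card_pos.1 (lt_of_lt_of_le (by norm_num) (h.five_le_card hT hp hmax))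
    obtain ⟨b, hb⟩ := hne
    rw [Finset.mem_filter, Finset.mem_range] at hb
    have hP : ∃ v, IsPathFn G T p v ∧ b < p ∧ G.Adj (v 0) (v b) := ⟨v, h, hb⟩
    refine ⟨Nat.findGreatest (fun b => ∃ v, IsPathFn G T p v ∧ b < p ∧ G.Adj (v 0) (v b)) p,
      Nat.findGreatest_spec (P := fun b => ∃ v, IsPathFn G T p v ∧ b < p ∧ G.Adj (v 0) (v b))
        hb.1.le hP, ?_⟩
    intro b v h1 h2 h3
    exact Nat.le_findGreatest h2.le ⟨v, h1, h2, h3⟩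
  have hA := h.five_le_card hT hp hmax
  have hB := h.five_le_card' hT hp hmax
  set A := (Finset.range p).filter fun j => G.Adj (v 0) (v j) with hAdef
  set B := (Finset.range p).filter fun j => G.Adj (v (p - 1)) (v j) with hBdef
  have hA' : ∀ x ∈ A, 0 < x ∧ x < p ∧ G.Adj (v 0) (v x) := by
    intro x hx
    rw [hAdef, Finset.mem_filter, Finset.mem_range] at hx
    refine ⟨Nat.pos_of_ne_zero ?_, hx⟩
    rintro rfl
    exact G.loopless.irrefl _ hx.2
  have hB' : B ⊆ Finset.Ico a (p - 1) := by
    intro x hx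
    rw [hBdef, Finset.mem_filter, Finset.mem_range] at hx
    rw [Finset.mem_Ico]
    constructor
    · by_contra hxa
      exact hno v x a h (by omega) hap hva hx.2
    · by_contra hx1
      obtain rfl : x = p - 1 := by omega
      exact G.loopless.irrefl _ hx.2
  by_cases ha : a ≤ 6
  · have hUcard : (A.image fun x => v (x - 1)).card = A.card := by
      refine Finset.card_image_of_injOn fun x hx y hy hxy => ?_
      have hx' := hA' x hx
      have hy' := hA' y hy
      have := h.inj _ (by omega) _ (by omega) hxy
      omega
    have hAa : ∀ x ∈ A, x ≤ a := fun x hx => hmaxa x v h (hA' x hx).2.1 (hA' x hx).2.2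
    have := hT.window (U := A.image fun x => v (x - 1)) (W := (Finset.range (a + 1)).image v)
      (by
        intro y hy
        obtain ⟨x, hx, rfl⟩ := Finset.mem_image.1 hy
        have := hA' x hx
        exact h.mem _ (by omega))
      (by
        intro y hy
        obtain ⟨x, hx, rfl⟩ := Finset.mem_image.1 hy
        have := hAa x hx
        exact Finset.mem_image.2 ⟨x - 1, Finset.mem_range.2 (by omega), rfl⟩)
      (Finset.card_pos.1 (by omega))
      (by
        intro u hu y hy huy
        obtain ⟨x, hx, rfl⟩ := Finset.mem_image.1 hu
        obtain ⟨hx0, hxp, hvx⟩ := hA' x hx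
        have hxa := hAa x hx
        have hr := h.rotate hxp hvx
        have hadj : G.Adj ((fun t => if t < x then v (x - 1 - t) else v t) 0) y := by
          simp only [if_pos hx0]; exact huy
        obtain ⟨j, hj, hjy⟩ := hr.exists_eq_of_adj hp hmax hy hadj
        rw [← hjy] at hadj
        have hja := hmaxa j _ hr hj hadj
        rw [← hjy]
        refine Finset.mem_image.2 ?_
        by_cases hjx : j < x
        · exact ⟨x - 1 - j, Finset.mem_range.2 (by omega), by simp [hjx]⟩
        · exact ⟨j, Finset.mem_range.2 (by omega), by simp [hjx]⟩)
    have hW : ((Finset.range (a + 1)).image v).card ≤ a + 1 :=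
      Finset.card_image_le.trans (by simp)
    omega
  · have hBcard := Finset.card_le_card hB'
    rw [Nat.card_Ico] at hBcard
    obtain rfl : p = 13 := by omega
    obtain rfl : a = 7 := by omega
    have hBeq : B = Finset.Ico 7 12 := Finset.eq_of_subset_of_card_le hB' (by simpa using hB)
    have hUcard : ((Finset.Ico 8 13).image v).card = 5 := by
      rw [Finset.card_image_of_injOn]
      · simp
      · intro x hx y hy hxy
        rw [Finset.coe_Ico, Set.mem_Ico] at hx hy
        exact h.inj _ (by omega) _ (by omega) hxy
    have := hT.window (U := (Finset.Ico 8 13).image v) (W := (Finset.Ico 7 13).image v)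
      (by
        intro y hy
        obtain ⟨x, hx, rfl⟩ := Finset.mem_image.1 hy
        exact h.mem _ (Finset.mem_Ico.1 hx).2)
      (Finset.image_subset_image (Finset.Ico_subset_Ico_left (by norm_num)))
      (Finset.card_pos.1 (by omega))
      (by
        intro u hu y hy huy
        obtain ⟨x, hx, rfl⟩ := Finset.mem_image.1 hu
        rw [Finset.mem_Ico] at hx
        have hk : x - 1 ∈ B := by rw [hBeq, Finset.mem_Ico]; omega
        rw [hBdef, Finset.mem_filter] at hk
        have hrr := h.reverse.rotate (i := 13 - x) (by omega) (by
          show G.Adj (v (13 - 1 - 0)) (v (13 - 1 - (13 - x)))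
          rw [show 13 - 1 - (13 - x) = x - 1 by omega]
          exact hk.2)
        set r := fun t => if t < 13 - x then v (13 - 1 - (13 - x - 1 - t)) else v (13 - 1 - t)
          with hr
        have hr0 : r 0 = v x := by
          simp only [hr]
          rw [if_pos (by omega)]
          congr 1; omega
        obtain ⟨j, hj, hjy⟩ := hrr.exists_eq_of_adj hp hmax hy (by
          rw [hr0]; exact huy)
        change r j = y at hjy
        have hj5 : j ≤ 5 := by
          by_contra hj5
          refine hno _ (12 - j) 7 hrr.reverse (by omega) (by norm_num) ?_ ?_
          · change G.Adj (r 12) (r 5)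
            simp only [hr]
            rw [if_neg (by omega), if_neg (by omega)]
            exact hva
          · change G.Adj (r 0) (r (12 - (12 - j)))
            rw [show 12 - (12 - j) = j by omega, hjy, hr0]; exact huy
        rw [← hjy]
        simp only [hr]
        refine Finset.mem_image.2 ?_
        split_ifs
        · exact ⟨_, Finset.mem_Ico.2 (by omega), rfl⟩
        · exact ⟨_, Finset.mem_Ico.2 (by omega), rfl⟩)
    have hW : ((Finset.Ico 7 13).image v).card ≤ 6 := Finset.card_image_le.trans (by simp)
    omega

end IsPathFn

theorem DenseOn.exists_long_cycle (hfree : twoP7.Free G) (hT : DenseOn G T) (hne : T.Nonempty) :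
    ∃ k c, 10 ≤ k ∧ CycMap G k c ∧ ∀ i, c i ∈ T := by
  have h13 : ∀ p, (∃ v, IsPathFn G T p v) → p ≤ 13 := fun p ⟨v, h⟩ => by
    simpa using h.isPathList.length_le hfree
  have hex : ∃ p, ¬ ∃ v, IsPathFn G T (p + 1) v := ⟨13, fun h => by have := h13 _ h; omega⟩
  classical
  have hmax := Nat.find_spec hex
  have hmin := fun m => Nat.find_min hex (m := m)
  generalize Nat.find hex = p at hmax hmin
  push Not at hmax
  obtain ⟨x, hx⟩ := hne
  have hp : 0 < p := by
    rcases Nat.eq_zero_or_pos p with rfl | h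
    · exact (hmax (fun _ => x) ⟨fun _ _ => hx, fun i hi j hj _ => by omega,
        fun i hi => by omega⟩).elim
    · exact h
  have hv := hmin (p - 1) (by omega)
  rw [not_not, show p - 1 + 1 = p by omega] at hv
  have hp13 := h13 p hv
  obtain ⟨v, hv⟩ := hv
  obtain ⟨w, i, j, hw, hij, hj, h1, h2⟩ := hv.exists_crossing hT hp hmax hp13
  exact hw.exists_cycMap_of_crossing hT hp hmax hij hj h1 h2

end

/-! ### Graphs whose longest cycles have length at most ten -/

section
variable {V : Type*} {G : SimpleGraph V} [DecidableRel G.Adj]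

theorem exists_adj_notMem [DecidableEq V] {T E : Finset V} {v : V} (h : E.card < degIn G T v) :
    ∃ w ∈ T, G.Adj v w ∧ w ∉ E := by
  rw [degIn, ← Finset.card_filter] at h
  obtain ⟨w, hw, hwE⟩ := Finset.exists_mem_notMem_of_card_lt_card h
  rw [Finset.mem_filter] at hw
  exact ⟨w, hw.1, hw.2, hwE⟩

theorem DenseOn.of_closed [DecidableEq V] {S U : Finset V} (hS : DenseOn G S) (hU : U ⊆ S)
    (hclosed : ∀ u ∈ U, ∀ y ∈ S \ U, ¬ G.Adj u y) : DenseOn G U := by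
  intro W hW hWne
  have h1 := hS W (hW.trans hU) hWne
  have h2 : adjSum G U (S \ U) = 0 := adjSum_eq_zero hclosed
  have h3 : adjSum G (U \ W) (S \ U) = 0 :=
    adjSum_eq_zero fun u hu => hclosed u (Finset.sdiff_subset hu)
  have h4 : S \ W = (S \ U) ∪ (U \ W) := by
    ext v
    simp only [Finset.mem_sdiff, Finset.mem_union]
    have := @hU v
    have := @hW v
    tauto
  have hd : Disjoint (S \ U) (U \ W) :=
    Finset.disjoint_of_subset_right Finset.sdiff_subset Finset.sdiff_disjoint
  have h5 : adjSum G S S = adjSum G (S \ U) (S \ U) + 2 * adjSum G U (S \ U) + adjSum G U U := by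
    rw [adjSum_sdiff_self hU, adjSum_comm (S \ U) U]; ring
  rw [h4, adjSum_union_self hd, h3] at h1
  rw [h5, h2] at h1
  omega

namespace CycMap
variable {c : ℤ → V}

section ten
variable [DecidableEq V] {C S : Finset V} (hfree : twoP7.Free G) (hc : CycMap G 10 c)
  (hC : ∀ v, v ∈ C ↔ ∃ i, c i = v) (hCS : C ⊆ S) (hS : DenseOn G S)
  (hmax : ∀ k c', 11 ≤ k → ¬ CycMap G k c')

include hfree hc hC hS in
theorem ten_not_closed {U : Finset V} (hU : U ⊆ S \ C) (hne : U.Nonempty)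
    (hclosed : ∀ u ∈ U, ∀ y ∈ S \ U, ¬ G.Adj u y) : False := by
  obtain ⟨k, c', hk, hc', hcU⟩ :=
    (hS.of_closed (hU.trans Finset.sdiff_subset) hclosed).exists_long_cycle hfree hne
  refine twoP7_free_absurd hfree (hc.isPathList_arc 0 (t := 7) (by omega))
    (hc'.isPathList_arc 0 (t := 7) (by omega)) (by simp) (by simp) ?_
  intro v hv hv'
  obtain ⟨s, -, hs⟩ := mem_arc.1 hv
  obtain ⟨s', -, rfl⟩ := mem_arc.1 hv'
  exact (Finset.mem_sdiff.1 (hU (hcU _))).2 ((hC _).2 ⟨_, hs⟩)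

include hfree hc hC in
omit [DecidableRel G.Adj] in
theorem ten_no_four {z y u w : V} (hz : z ∈ S \ C) (hy : y ∈ S \ C) (hu : u ∈ S \ C)
    (hw : w ∈ S \ C) (hatt : ∃ i, G.Adj z (c i)) (hzy : G.Adj z y) (hyu : G.Adj y u)
    (huw : G.Adj u w) (hzu : u ≠ z) (hwz : w ≠ z) (hwy : w ≠ y) : False := by
  obtain ⟨i, hi⟩ := hatt
  have hp : IsPathList G [w, u, y, z] :=
    ⟨by simp [hzy.symm, hyu.symm, huw.symm],
      by simp [hyu.ne.symm, hzy.ne.symm, huw.ne.symm, hzu, hwz, hwy]⟩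
  have := (hc.isPathList_append_arc hp (i := i) (by
    intro v hv j hj
    have hvC : v ∈ C := (hC v).2 ⟨j, hj⟩
    simp only [Finset.mem_sdiff] at hz hy hu hw
    simp only [List.mem_cons, List.not_mem_nil, or_false] at hv
    rcases hv with rfl | rfl | rfl | rfl
    exacts [hw.2 hvC, hu.2 hvC, hy.2 hvC, hz.2 hvC]) le_rfl (by simpa using hi)).length_le hfree
  simp at this

include hc hC hmax in
omit [DecidableEq V] in
/-- The end vertices of an outer path have their neighbours far apart on the cycle. -/
theorem ten_degIn_le_farPoints {q : List V} (hq : IsPathList G q) (hqC : ∀ v ∈ q, v ∉ C) {z w : V}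
    (hh : q.head? = some z) (hl : q.getLast? = some w) :
    degIn G C w ≤ farPoints 10 (q.length + 1) (nbrMask G 10 c z) := by
  have hq0 : q ≠ [] := by rintro rfl; simp at hh
  have hd : ∀ v ∈ q, ∀ i, c i ≠ v := fun v hv i h => hqC v hv ((hC v).2 ⟨i, h⟩)
  have far : ∀ (i j : ℤ), G.Adj z (c i) → G.Adj w (c j) → ∀ m : ℕ, 0 < m → m < 10 →
      (j - i) % 10 = m → q.length + 1 ≤ m := by
    intro i j hi hj m hm0 hm10 hmod
    by_contra hlt
    obtain ⟨c', h⟩ := hc.exists_detour hq hd (i := i) (m := m) hm0 hm10.le hq0 (by simpa [hh])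
      (by
        have : c (i + m) = c j := by rw [hc.eq_iff]; omega
        simpa [hl, this])
    exact hmax _ _ (by omega) h
  have far' : ∀ (i j : ℤ), G.Adj z (c i) → G.Adj w (c j) → ∀ m : ℕ, 0 < m → m < 10 →
      (i - j) % 10 = m → q.length + 1 ≤ m := by
    intro i j hi hj m hm0 hm10 hmod
    by_contra hlt
    obtain ⟨c', h⟩ := hc.exists_detour hq.reverse (by simpa using hd) (i := j) (m := m) hm0 hm10.le
      (by simpa using hq0) (by simpa [hl])
      (by
        have : c (j + m) = c i := by rw [hc.eq_iff]; omega
        simpa [hh, this])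
    rw [List.length_reverse] at h
    exact hmax _ _ (by omega) h
  rw [hc.degIn_eq hC (by norm_num), maskCard, farPoints, sumBelow_eq, sumBelow_eq]
  refine Finset.sum_le_sum fun j hj => ?_
  rw [Finset.mem_range] at hj
  rw [hc.cycBit_nbrMask (by norm_num)]
  by_cases h : G.Adj w (c j)
  · rw [allBelow_iff.2]
    · exact Bool.toNat_le _
    · intro i hi10
      rw [hc.cycBit_nbrMask (by norm_num)]
      by_cases hi : G.Adj z (c i)
      · by_cases hij : i = j
        · simp [hij]
        · have h1 := far i j hi h ((j + (10 - i)) % 10) (by omega) (by omega) (by omega)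
          have h2 := far' i j hi h ((i + (10 - j)) % 10) (by omega) (by omega) (by omega)
          rw [decide_eq_true h1, decide_eq_true h2]; simp
      · simp [hi]
  · simp [h]

include hc hC hmax in
omit [DecidableEq V] in
theorem ten_mask {z : V} (hz : z ∉ C) : degIn G C z ≤ 5 ∧
    (3 ≤ degIn G C z → farPoints 10 4 (nbrMask G 10 c z) ≤ 2) ∧
    (4 ≤ degIn G C z → farPoints 10 3 (nbrMask G 10 c z) ≤ 1) ∧
    (5 ≤ degIn G C z → isTranslate 10 341 (nbrMask G 10 c z) = true) := by
  have hm := allBelow_iff.1 mask_ten _ (nbrMask_lt (G := G) (k := 10) (c := c) z)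
  rw [hc.sparse_nbrMask (by norm_num) (fun c' => hmax 11 c' le_rfl)
    (fun i h => hz ((hC z).2 ⟨i, h⟩)), ← hc.degIn_eq hC (by norm_num)] at hm
  generalize hd : degIn G C z = d at *
  have hd6 : d < 6 := by
    by_contra! h6
    obtain ⟨e, rfl⟩ : ∃ e, d = e + 6 := ⟨d - 6, by omega⟩
    simp at hm
  interval_cases d <;> simp at hm ⊢ <;> tauto

include hfree hc hC hCS hS hmax in
/-- Outer vertices of a dense set have no common edges. -/
theorem ten_not_adj_of_attached {z y : V} (hz : z ∈ S \ C) (hy : y ∈ S \ C)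
    (hatt : ∃ i, G.Adj z (c i)) : ¬ G.Adj z y := by
  have hnC : ∀ v ∈ S \ C, v ∉ C := fun v hv => (Finset.mem_sdiff.1 hv).2
  have hdeg : ∀ v ∈ S \ C, 5 ≤ degIn G C v + degIn G (S \ C) v := by
    intro v hv
    have h := hS.five_le_degIn (Finset.mem_sdiff.1 hv).1
    rwa [← Finset.union_sdiff_of_subset hCS, degIn, Finset.sum_union Finset.disjoint_sdiff] at h
  have hatt' : ∀ v, 0 < degIn G C v → ∃ i, G.Adj v (c i) := by
    intro v hv
    by_contra! hno
    have : degIn G C v = 0 := degIn_eq_zero.2 fun y hy => by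
      obtain ⟨i, rfl⟩ := (hC y).1 hy
      exact hno i
    omega
  have far2 : ∀ z ∈ S \ C, ∀ y ∈ S \ C, G.Adj z y →
      degIn G C y ≤ farPoints 10 3 (nbrMask G 10 c z) := fun z hz y hy h =>
    ten_degIn_le_farPoints hc hC hmax (isPathList_pair h) (by
      intro v hv
      simp only [List.mem_cons, List.not_mem_nil, or_false] at hv
      rcases hv with rfl | rfl
      exacts [hnC _ hz, hnC _ hy]) (by simp) (by simp)
  have far3 : ∀ z ∈ S \ C, ∀ y ∈ S \ C, ∀ u ∈ S \ C, G.Adj z y → G.Adj y u → u ≠ z →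
      degIn G C u ≤ farPoints 10 4 (nbrMask G 10 c z) := fun z hz y hy u hu h h' hne =>
    ten_degIn_le_farPoints hc hC hmax (q := [z, y, u])
      ⟨by simp [h, h'], by simp [h.ne, h'.ne, hne.symm]⟩ (by
      intro v hv
      simp only [List.mem_cons, List.not_mem_nil, or_false] at hv
      rcases hv with rfl | rfl | rfl
      exacts [hnC _ hz, hnC _ hy, hnC _ hu]) (by simp) (by simp)
  have hle3 : ∀ z ∈ S \ C, ∀ y ∈ S \ C, G.Adj z y → degIn G C z ≤ 3 := by
    intro z hz y hy hzy
    by_contra! h4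
    have hza := hatt' z (by omega)
    obtain ⟨-, hm4, hm3, -⟩ := ten_mask hc hC hmax (hnC z hz)
    have hy1 := (far2 z hz y hy hzy).trans (hm3 (by omega))
    have hyd := hdeg y hy
    obtain ⟨u, hu, hyu, huz⟩ := exists_adj_notMem (E := {z}) (T := S \ C) (v := y) (G := G)
      (by rw [Finset.card_singleton]; omega)
    rw [Finset.mem_singleton] at huz
    have hu2 := (far3 z hz y hy u hu hzy hyu huz).trans (hm4 (by omega))
    have hud := hdeg u hu
    obtain ⟨w, hw, huw, hwE⟩ := exists_adj_notMem (E := {z, y}) (T := S \ C) (v := u) (G := G)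
      (by have := Finset.card_le_two (a := z) (b := y); omega)
    simp only [Finset.mem_insert, Finset.mem_singleton, not_or] at hwE
    exact ten_no_four hfree hc hC hz hy hu hw hza hzy hyu huw huz hwE.1 hwE.2
  intro hzy
  have hy3 := hle3 y hy z hz hzy.symm
  have hyd := hdeg y hy
  obtain ⟨u, hu, hyu, huz⟩ := exists_adj_notMem (E := {z}) (T := S \ C) (v := y) (G := G)
    (by rw [Finset.card_singleton]; omega)
  rw [Finset.mem_singleton] at huz
  have hu3 := hle3 u hu y hy hyu.symm
  have hud := hdeg u hu
  have huz' : G.Adj z u := by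
    obtain ⟨w, hw, huw, hwy⟩ := exists_adj_notMem (E := {y}) (T := S \ C) (v := u) (G := G)
      (by rw [Finset.card_singleton]; omega)
    rw [Finset.mem_singleton] at hwy
    by_cases hwz : w = z
    · exact hwz ▸ huw.symm
    · exact (ten_no_four hfree hc hC hz hy hu hw hatt hzy hyu huw huz hwz hwy).elim
  have hu2 : degIn G (S \ C) u ≤ 2 := by
    by_contra! h
    obtain ⟨w, hw, huw, hwE⟩ := exists_adj_notMem (E := {z, y}) (T := S \ C) (v := u) (G := G)
      (by have := Finset.card_le_two (a := z) (b := y); omega)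
    simp only [Finset.mem_insert, Finset.mem_singleton, not_or] at hwE
    exact ten_no_four hfree hc hC hz hy hu hw hatt hzy hyu huw huz hwE.1 hwE.2
  have hy2 : degIn G (S \ C) y ≤ 2 := by
    by_contra! h
    obtain ⟨w, hw, hyw, hwE⟩ := exists_adj_notMem (E := {z, u}) (T := S \ C) (v := y) (G := G)
      (by have := Finset.card_le_two (a := z) (b := u); omega)
    simp only [Finset.mem_insert, Finset.mem_singleton, not_or] at hwE
    exact ten_no_four hfree hc hC hz hu hy hw hatt huz' hyu.symm hyw hzy.ne.symm hwE.1 hwE.2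
  have h1 := far3 u hu z hz y hy huz'.symm hzy hyu.ne
  have h2 := (ten_mask hc hC hmax (hnC u hu)).2.1 (by omega)
  omega

include hfree hc hC hCS hS hmax in
theorem ten_not_adj {z y : V} (hz : z ∈ S \ C) (hy : y ∈ S \ C) : ¬ G.Adj z y := by
  intro hzy
  refine ten_not_closed hfree hc hC hS (U := (S \ C).filter fun v => ∃ w ∈ S \ C, G.Adj v w)
    (Finset.filter_subset _ _) ⟨z, Finset.mem_filter.2 ⟨hz, y, hy, hzy⟩⟩ ?_
  intro u hu v hv huv
  rw [Finset.mem_filter] at hu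
  obtain ⟨hu, w, hw, huw⟩ := hu
  simp only [Finset.mem_sdiff, Finset.mem_filter, not_and] at hv
  by_cases hvC : v ∈ C
  · obtain ⟨i, rfl⟩ := (hC v).1 hvC
    exact ten_not_adj_of_attached hfree hc hC hCS hS hmax hu hw ⟨i, huv⟩ huw
  · exact hv.2 ⟨hv.1, hvC⟩ ⟨u, Finset.mem_sdiff.1 hu, huv.symm⟩

include hc hmax in
omit [DecidableRel G.Adj] [DecidableEq V] in
/-- Two outer vertices cannot be inserted at consecutive places. -/
theorem ten_not_interleaved {z w : V} (hz : ∀ i, c i ≠ z) (hw : ∀ i, c i ≠ w) (hzw : z ≠ w) {j : ℤ}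
    (h1 : G.Adj z (c (j - 1))) (h2 : G.Adj z (c (j + 1))) (h3 : G.Adj w (c j)) :
    ¬ G.Adj w (c (j + 2)) := by
  intro h4
  have hfull := hc.isPathList_arc j (t := 2 + 8) (by omega)
  rw [arc_add] at hfull
  obtain ⟨-, hb, hab, -⟩ := isPathList_append.1 hfull
  have hab' : c j ∉ arc c (j + 2) 8 ∧ c (j + 1) ∉ arc c (j + 2) 8 := by
    constructor <;> intro h <;> refine hab (mem_arc.2 ?_) h
    · exact ⟨0, by norm_num, by simp⟩
    · exact ⟨1, by norm_num, by simp⟩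
  have hadj := hc.adj j
  have hq : IsPathList G [z, c (j + 1), c j, w] :=
    ⟨by simp [h2, hadj.symm, h3.symm],
      by simp [hadj.ne.symm, (hz _).symm, hw, hzw]⟩
  have hp : IsPathList G ([z, c (j + 1), c j, w] ++ arc c (j + 2) 8) := by
    refine isPathList_append.2 ⟨hq, hb, ?_, ?_⟩
    · intro v hv hv'
      simp only [List.mem_cons, List.not_mem_nil, or_false] at hv
      rcases hv with rfl | rfl | rfl | rfl
      · obtain ⟨s, -, hs⟩ := mem_arc.1 hv'
        exact hz _ hs
      · exact hab'.2 hv'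
      · exact hab'.1 hv'
      · obtain ⟨s, -, hs⟩ := mem_arc.1 hv'
        exact hw _ hs
    · intro x hx y hy
      rw [arc_head? (by omega)] at hy
      have hx' : w = x := by simpa using hx
      cases hy
      rw [← hx']
      exact h4
  obtain ⟨c', h, -⟩ := cycMap_of_list hp (by simp) (by
    intro x hx y hy
    rw [List.getLast?_append, arc_getLast? (by omega)] at hx
    have hx' : c (j + 2 + (8 : ℕ) - 1) = x := by simpa using hx
    have hy' : z = y := by simpa using hy
    have hper := hc.add_period (j - 1)
    rw [← hx', ← hy', show j + 2 + ((8 : ℕ) : ℤ) - 1 = j - 1 + (10 : ℕ) by push_cast; ring, hper]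
    exact h1.symm)
  exact hmax _ _ (by simp) h

include hfree hc hC hCS hS hmax in
theorem ten_adjSum_le (hcard : 10 < S.card) : adjSum G S S + 30 ≤ 10 * S.card := by
  have hCcard := hc.card_eq hC (by norm_num)
  have hnC : ∀ v ∈ S \ C, ∀ i, c i ≠ v := fun v hv i h =>
    (Finset.mem_sdiff.1 hv).2 ((hC v).2 ⟨i, h⟩)
  have hpar : ∀ z ∈ S \ C, degIn G C z = 5 ∧ ∃ t : ℤ, ∀ i : ℤ, G.Adj z (c i) ↔ (i - t) % 2 = 0 := by
    intro z hz
    have h0 : degIn G (S \ C) z = 0 := degIn_eq_zero.2 fun y hy =>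
      ten_not_adj hfree hc hC hCS hS hmax hz hy
    have h := hS.five_le_degIn (Finset.mem_sdiff.1 hz).1
    rw [← Finset.union_sdiff_of_subset hCS, degIn, Finset.sum_union Finset.disjoint_sdiff] at h
    change 5 ≤ degIn G C z + degIn G (S \ C) z at h
    obtain ⟨h5, -, -, htr⟩ := ten_mask hc hC hmax (Finset.mem_sdiff.1 hz).2
    refine ⟨by omega, ?_⟩
    obtain ⟨t, ht⟩ := hc.exists_translate (by norm_num) (htr (by omega))
    refine ⟨t, fun i => ?_⟩
    obtain ⟨s, hs, hsi⟩ := hc.exists_eq (by norm_num) t i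
    have hbits : ∀ s < 10, Nat.testBit 341 s = true ↔ s % 2 = 0 := by decide
    have hmod := (hc.eq_iff _ _).1 hsi
    rw [← hsi, add_comm t, ht s hs, hbits s hs]
    omega
  obtain ⟨z, hz⟩ : (S \ C).Nonempty := Finset.card_pos.1 (by
    rw [Finset.card_sdiff_of_subset hCS]; omega)
  obtain ⟨hz5, t, ht⟩ := hpar z hz
  have hX : (C.filter fun v => G.Adj z v).card = 5 := by
    rw [← hz5, degIn, ← Finset.card_filter]
  set X := C.filter fun v => G.Adj z v with hXdef
  have hXS : X ⊆ S := (Finset.filter_subset _ _).trans hCS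
  have hout : ∀ w ∈ S \ C, ∀ v ∈ S \ X, ¬ G.Adj w v := by
    intro w hw v hv hwv
    by_cases hvC : v ∈ C
    · obtain ⟨j, rfl⟩ := (hC v).1 hvC
      rw [hXdef, Finset.mem_sdiff, Finset.mem_filter, ht] at hv
      have hj : ¬ (j - t) % 2 = 0 := fun h => hv.2 ⟨hvC, h⟩
      have hzw : z ≠ w := by rintro rfl; rw [ht] at hwv; exact hj hwv
      obtain ⟨-, t', ht'⟩ := hpar w hw
      have hw2 : G.Adj w (c (j + 2)) := by rw [ht'] at hwv ⊢; omega
      refine hc.ten_not_interleaved hmax (hnC z hz) (hnC w hw) hzw (j := j) ?_ ?_ hwv hw2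
      · rw [ht]; omega
      · rw [ht]; omega
    · exact ten_not_adj hfree hc hC hCS hS hmax hw
        (Finset.mem_sdiff.2 ⟨(Finset.mem_sdiff.1 hv).1, hvC⟩) hwv
  have hind : adjSum G (S \ X) (S \ X) = 0 := by
    refine adjSum_eq_zero fun u hu v hv huv => ?_
    by_cases huC : u ∈ C
    · by_cases hvC : v ∈ C
      · obtain ⟨i, rfl⟩ := (hC u).1 huC
        obtain ⟨j, rfl⟩ := (hC v).1 hvC
        rw [hXdef, Finset.mem_sdiff, Finset.mem_filter, ht] at hu hv
        have hi : ¬ (i - t) % 2 = 0 := fun h => hu.2 ⟨huC, h⟩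
        have hj : ¬ (j - t) % 2 = 0 := fun h => hv.2 ⟨hvC, h⟩
        refine hc.not_adj_succ_succ (by norm_num) (fun c' => hmax 11 c' le_rfl) (hnC z hz)
          (i := i - 1) (j := j - 1) ?_ ?_ (by simpa using huv)
        · rw [ht]; omega
        · rw [ht]; omega
      · exact hout v (Finset.mem_sdiff.2 ⟨(Finset.mem_sdiff.1 hv).1, hvC⟩) u hu huv.symm
    · exact hout u (Finset.mem_sdiff.2 ⟨(Finset.mem_sdiff.1 hu).1, huC⟩) v hv huv
  have h1 := adjSum_self_le (G := G) X
  have h2 : adjSum G (S \ X) X ≤ (S \ X).card * X.card := by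
    rw [adjSum_eq_card, ← Finset.card_product]
    exact Finset.card_filter_le _ _
  rw [Finset.card_sdiff_of_subset hXS] at h2
  rw [adjSum_sdiff_self hXS, hind]
  rw [hX] at h1 h2
  omega

end ten

end CycMap

/-- Vertices can be deleted until the remaining set is dense, losing at most four edges for each
of them. -/
theorem exists_denseOn [Fintype V] [DecidableEq V] : ∃ S : Finset V, DenseOn G S ∧
    2 * G.edgeFinset.card ≤ adjSum G S S + 8 * (Fintype.card V - S.card) := by
  have hne : ((Finset.univ : Finset (Finset V)).filter fun S =>
      2 * G.edgeFinset.card ≤ adjSum G S S + 8 * (Fintype.card V - S.card)).Nonempty :=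
    ⟨Finset.univ, by simp [adjSum_univ]⟩
  obtain ⟨S, hS, hmin⟩ := Finset.exists_min_image _ Finset.card hne
  rw [Finset.mem_filter] at hS
  refine ⟨S, fun U hU hUne => ?_, hS.2⟩
  by_contra! hle
  have hcard := Finset.card_sdiff_of_subset hU
  have h1 := Finset.card_le_card hU
  have h2 := Finset.card_pos.2 hUne
  have h3 := Finset.card_le_univ S
  have := hmin (S \ U) (Finset.mem_filter.2 ⟨Finset.mem_univ _, by
    rw [hcard]
    have := hS.2
    omega⟩)
  omega

theorem lt_of_no_eleven [Fintype V] [DecidableEq V] (hfree : twoP7.Free G)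
    (hcard : 14 ≤ Fintype.card V) (hmax : ∀ k c', 11 ≤ k → ¬ CycMap G k c') :
    G.edgeFinset.card < max (pathBracket (Fintype.card V) 14 7) (5 * Fintype.card V - 14) := by
  obtain ⟨S, hS, hle⟩ := exists_denseOn (G := G)
  apply lt_bound hcard
  have hself := adjSum_self_le (G := G) S
  have hSn := Finset.card_le_univ S
  by_cases h10 : S.card ≤ 10
  · generalize S.card = s at *
    interval_cases s <;> omega
  · obtain ⟨k, c, hk, hc, hcS⟩ := hS.exists_long_cycle hfree (Finset.card_pos.1 (by omega))
    have hk10 : k = 10 := by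
      by_contra h
      exact hmax k c (by omega) hc
    subst hk10
    have := hc.ten_adjSum_le hfree (C := (Set.range c).toFinite.toFinset) (fun v => by simp)
      (fun v hv => by
        obtain ⟨i, rfl⟩ : ∃ i, c i = v := by simpa using hv
        exact hcS i) hS hmax (by omega)
    omega

end

theorem lemma2p3 {V : Type*} [Fintype V] (G : SimpleGraph V) [DecidableRel G.Adj] (n : ℕ)
    (hn : 14 ≤ n) (hcard : Fintype.card V = n) (hconn : G.Connected) (hfree : twoP7.Free G) :
    G.edgeFinset.card ≤ max (pathBracket n 14 7) (5 * n - 14) ∧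
      (G.edgeFinset.card = max (pathBracket n 14 7) (5 * n - 14) →
        22 ≤ n ∧ Nonempty (G ≃g extremalGraph n)) := by
  classical
  subst hcard
  suffices h : G.edgeFinset.card < max (pathBracket (Fintype.card V) 14 7)
      (5 * Fintype.card V - 14) ∨ (G.edgeFinset.card ≤ 5 * Fintype.card V - 14 ∧
      (G.edgeFinset.card = 5 * Fintype.card V - 14 →
        Nonempty (G ≃g extremalGraph (Fintype.card V)))) by
    rcases h with h | ⟨hle, heq⟩
    · exact ⟨h.le, fun h' => (h.ne h').elim⟩
    · refine ⟨hle.trans (le_max_right _ _), fun h' => ?_⟩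
      have h22 : 22 ≤ Fintype.card V := by
        by_contra! hlt
        exact (lt_bound_of_le hn hle hlt).ne h'
      exact ⟨h22, heq (le_antisymm hle (h' ▸ le_max_right _ _))⟩
  by_cases h12 : ∃ c, CycMap G 12 c
  · obtain ⟨c, hc⟩ := h12
    exact Or.inl (hc.lt_of_twelve hfree hconn hn)
  have hmax : ∀ k c', 12 ≤ k → ¬ CycMap G k c' := fun k c' hk hc' => by
    have := hc'.length_lt hfree hconn hn
    obtain rfl : k = 12 := by omega
    exact h12 ⟨c', hc'⟩
  by_cases h11 : ∃ c, CycMap G 11 c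
  · obtain ⟨c, hc⟩ := h11
    exact hc.eleven_bound hfree hconn (C := (Set.range c).toFinite.toFinset) (fun v => by simp)
      hn hmax
  · refine Or.inl (lt_of_no_eleven hfree hn fun k c' hk hc' => ?_)
    rcases Nat.lt_or_ge k 12 with h | h
    · obtain rfl : k = 11 := by omega
      exact h11 ⟨c', hc'⟩
    · exact hmax k c' h hc'
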